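/- Conventions. For a symmetric function $K:X\times X\to[0,\infty)$ and an $n\times n$ symmetric stochastic matrix $A=(a_{ij})$, let $\gamma_+(A,K)\in[0,\infty]$ be the infimum of those $\gamma\in(0,\infty]$ such that for all $x_1,\dots,x_n,y_1,\dots,y_n\in X$ $$\frac1{n^2}\sum_{i,j=1}^n K(x_i,y_j)\le\frac{\gamma}{n}\sum_{i,j=1}^n a_{ij}K(x_i,y_j)$$ (with $\gamma=\infty$ always admitted). Write $\mathscr A_t(A)=\frac1t\sum_{s=0}^{t-1}A^s$ for $t\in\mathbb N=\{1,2,\dots\}$. Graphs are finite and non-oriented, with self loops and multiple edges allowed; a self loop contributes $1$ to the degree. For a $d$-regular graph $G$ ($d\ge1$) with normalized adjacency matrix $A_G$ put $\gamma_+(G,K)=\gamma_+(A_G,K)$, and let $\mathscr A_t(G)$ be the $td^{t-1}$-regular graph on the same vertices in which every walk of length $s\in\{0,\dots,t-1\}$ in $G$ from $u$ to $v$ contributes $d^{t-1-s}$ edges joining $u$ and $v$. The pair $(X,K)$ has the uniform decay property if for every $M\in(1,\infty)$ there are $t\in\mathbb N$ and $\Gamma\in[1,\infty)$ such that for every $n\in\mathbb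 N$ and every $n\times n$ symmetric stochastic matrix $A$, $\gamma_+(A,K)\ge\Gamma$ implies $\gamma_+(\mathscr A_t(A),K)\le\gamma_+(A,K)/M$. Proposition. Let $X$ be the set of all bounded integer-valued sequences, with the metric $\rho(x,y)=\log(1+\|x-y\|_\infty)$. There are a constant $\eta\in(0,\infty)$ and, for every $n\in\mathbb N$, an $n$-vertex regular graph $G_n$ with $\gamma_+(G_n,\rho^2)<\infty$, such that $\lim_{n\to\infty}\gamma_+(G_n,\rho^2)=\infty$, yet for every $t\in\mathbb N$ there exists $n_0\in\mathbb N$ such that $$n\ge n_0\implies\gamma_+(\mathscr A_t(G_n),\rho^2)\ge\eta\cdot\gamma_+(G_n,\rho^2).$$ Consequently $(X,\rho^2)$ does not have the uniform decay property. -/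

import Mathlib

open Filter Topology
open scoped NNReal ENNReal

namespace SpectralCalculus

/-! ### Finite regular multigraphs -/

/-- A finite non-oriented regular graph of positive degree, self loops and multiple edges allowed.
It is given by the symmetric matrix of multiplicities of ordered pairs; in particular, a self loop
contributes `1` to the degree of its vertex. -/
structure RegularMultigraph (V : Type*) [Fintype V] where
  /-- the number of times that the ordered pair `(u, v)` occurs as an edge -/
  mult : V → V → ℕ
  symm : ∀ u v, mult u v = mult v u
  degree : ℕ
  degree_pos : 0 < degree
  sum_mult : ∀ u, ∑ v, mult u v = degree

namespace RegularMultigraph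

variable {V : Type*} [Fintype V] [DecidableEq V]

/-- The normalized adjacency matrix `A_G`. -/
noncomputable def normAdj (G : RegularMultigraph V) : Matrix V V ℝ :=
  Matrix.of fun u v => (G.mult u v : ℝ) / (G.degree : ℝ)

/-- The number of walks of length `t` from `u` to `v`, counted with edge multiplicities. -/
def walkCount (G : RegularMultigraph V) : ℕ → V → V → ℕ
  | 0, u, v => if u = v then 1 else 0
  | t + 1, u, v => ∑ w, G.mult u w * walkCount G t w v

theorem walkCount_eq_pow (G : RegularMultigraph V) (t : ℕ) (u v : V) :
    G.walkCount t u v = ((Matrix.of G.mult) ^ t) u v := by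
  induction t generalizing u v with
  | zero => simp [walkCount, Matrix.one_apply]
  | succ t ih => simp [walkCount, pow_succ', Matrix.mul_apply, ih]

theorem walkCount_symm (G : RegularMultigraph V) (t : ℕ) (u v : V) :
    G.walkCount t u v = G.walkCount t v u := by
  have h : (Matrix.of G.mult).transpose = Matrix.of G.mult := by
    ext i j
    exact G.symm j i
  rw [walkCount_eq_pow, walkCount_eq_pow]
  conv_lhs => rw [← h, ← Matrix.transpose_pow, Matrix.transpose_apply]

theorem sum_walkCount (G : RegularMultigraph V) (t : ℕ) (u : V) :
    ∑ v, G.walkCount t u v = G.degree ^ t := by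
  induction t generalizing u with
  | zero => simp [walkCount]
  | succ t ih =>
    simp only [walkCount]
    rw [Finset.sum_comm]
    simp only [← Finset.mul_sum, ih]
    rw [← Finset.sum_mul, G.sum_mult, pow_succ']

/-- The Cesàro average graph `𝒜_m(G)`, `m ≥ 1`, of a `d`-regular graph `G`: for every
`t ∈ {0, …, m - 1}`, every walk of length `t` from `u` to `v` contributes `d ^ (m - 1 - t)` edges
joining `u` and `v`. It is regular of degree `m * d ^ (m - 1)`. -/
def cesaro (G : RegularMultigraph V) (m : ℕ) (hm : 1 ≤ m) : RegularMultigraph V where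
  mult u v := ∑ t ∈ Finset.range m, G.degree ^ (m - 1 - t) * G.walkCount t u v
  symm u v := by
    refine Finset.sum_congr rfl fun t _ => ?_
    rw [walkCount_symm]
  degree := m * G.degree ^ (m - 1)
  degree_pos := Nat.mul_pos hm (pow_pos G.degree_pos _)
  sum_mult u := by
    rw [Finset.sum_comm]
    have h : ∀ t ∈ Finset.range m,
        ∑ v, G.degree ^ (m - 1 - t) * G.walkCount t u v = G.degree ^ (m - 1) := by
      intro t ht
      rw [← Finset.mul_sum, sum_walkCount, ← pow_add]
      congr 1
      have := Finset.mem_range.mp ht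
      omega
    rw [Finset.sum_congr rfl h]
    simp

end RegularMultigraph

/-! ### Poincaré constants -/

/-- The Poincaré constant `γ₊(A, K)` of an `n × n` matrix with respect to a kernel
`K : X × X → [0, ∞)`: the infimum of the positive `c` with
`(1 / n²) ∑ᵢⱼ K(xᵢ, yⱼ) ≤ (c / n) ∑ᵢⱼ aᵢⱼ K(xᵢ, yⱼ)` for all `x, y`. It is `∞` if there is no
such finite `c`. -/
noncomputable def gammaPlus {V X : Type*} [Fintype V] (A : Matrix V V ℝ)
    (K : X → X → ℝ≥0) : ℝ≥0∞ :=
  ⨅ (c : ℝ) (_ : 0 < c ∧ ∀ x y : V → X,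
      (1 / (Fintype.card V : ℝ) ^ 2) * ∑ i, ∑ j, (K (x i) (y j) : ℝ) ≤
        (c / (Fintype.card V : ℝ)) * ∑ i, ∑ j, A i j * (K (x i) (y j) : ℝ)),
    ENNReal.ofReal c

/-- `γ₊(G, K) = γ₊(A_G, K)` for a regular graph `G`. -/
noncomputable def RegularMultigraph.gammaPlus {V X : Type*} [Fintype V] [DecidableEq V]
    (G : RegularMultigraph V) (K : X → X → ℝ≥0) : ℝ≥0∞ :=
  SpectralCalculus.gammaPlus G.normAdj K

/-- Symmetric stochastic matrices. -/
def IsSymmStochastic {V : Type*} [Fintype V] (A : Matrix V V ℝ) : Prop :=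
  A.IsSymm ∧ (∀ i j, 0 ≤ A i j) ∧ ∀ i, ∑ j, A i j = 1

/-- The Cesàro average `𝒜_m(A) = (1 / m) ∑_{t < m} A ^ t` of a matrix. -/
noncomputable def matrixCesaro {V : Type*} [Fintype V] [DecidableEq V]
    (m : ℕ) (A : Matrix V V ℝ) : Matrix V V ℝ :=
  (1 / (m : ℝ)) • ∑ t ∈ Finset.range m, A ^ t

/-- The uniform decay property of Poincaré constants of `(X, K)`. Kernels are symmetric, as is
the case for the one used below. -/
def UniformDecay {X : Type*} (K : X → X → ℝ≥0) : Prop :=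
  ∀ M : ℝ, 1 < M → ∃ t : ℕ, 1 ≤ t ∧ ∃ Γ : ℝ, 1 ≤ Γ ∧
    ∀ n : ℕ, 1 ≤ n → ∀ A : Matrix (Fin n) (Fin n) ℝ, IsSymmStochastic A →
      ENNReal.ofReal Γ ≤ gammaPlus A K →
        gammaPlus (matrixCesaro t A) K ≤ gammaPlus A K / ENNReal.ofReal M

/-! ### The metric space of bounded integer sequences -/

/-- `X = ℓ_∞ ∩ ℤ^ℕ`, the bounded integer-valued sequences. -/
structure IntSeq where
  toLp : lp (fun _ : ℕ => ℝ) ∞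
  isInt : ∀ i, ∃ k : ℤ, toLp i = (k : ℝ)

/-- The metric `ρ(x, y) = log (1 + ‖x - y‖_∞)` on the bounded integer-valued sequences. -/
noncomputable instance : MetricSpace IntSeq where
  dist x y := Real.log (1 + ‖x.toLp - y.toLp‖)
  dist_self x := by simp
  dist_comm x y := by rw [norm_sub_rev]
  dist_triangle x y z := by
    have h1 := norm_nonneg (x.toLp - y.toLp)
    have h2 := norm_nonneg (y.toLp - z.toLp)
    have h3 := norm_nonneg (x.toLp - z.toLp)
    have h := norm_sub_le_norm_sub_add_norm_sub x.toLp y.toLp z.toLp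
    rw [← Real.log_mul (by positivity) (by positivity)]
    apply Real.log_le_log (by positivity)
    nlinarith [mul_nonneg h1 h2]
  eq_of_dist_eq_zero := by
    intro x y h
    have h1 := norm_nonneg (x.toLp - y.toLp)
    have h0 : ‖x.toLp - y.toLp‖ = 0 := by
      by_contra hne
      have hpos : 0 < ‖x.toLp - y.toLp‖ := lt_of_le_of_ne h1 (Ne.symm hne)
      exact (Real.log_pos (by linarith)).ne' h
    cases x
    cases y
    simpa [sub_eq_zero] using h0

/-- The kernel `ρ²` of a metric space. -/
noncomputable def sqDist (X : Type*) [MetricSpace X] : X → X → ℝ≥0 :=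
  fun x y => nndist x y ^ 2

end SpectralCalculus

/-! The graphs are expanders with a uniform spectral gap in which most pairs of vertices are at
distance at least a fixed power of `log n`, up to constants. Both `γ₊(G, ρ²)` and `γ₊(𝒜_t(G), ρ²)`
then have order `(log log n) ^ 2`: the logarithm in `ρ` turns the factor `t` by which averaging
shortens distances into an additive term `log t`.

Upper bound (`HasRealGap.sum_dist_sq_le`). Let `τ ^ 2` be a large multiple of the average of `ρ ^ 2`
over the edges. By Chebyshev most edges have norm length at most `T = exp τ - 1`, and length `0` if
`τ < log 2`, since the sequences are integral. The short edges still expand outside a small set, so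
some norm ball of radius `D * T`, with `D` of order `log n`, contains a quarter of the vertices. Its
`ρ`-radius is at most `L * τ`, with `L` of order `log log n`. The real Poincaré inequality for the
excess of `ρ` over this radius controls the remaining vertices. Laziness passes from one family of
points to two.

Lower bound (`RegularMultigraph.le_gammaPlus_of_lipschitz`). A Fréchet embedding, divided by `t` and
rounded to integers, sends the edges of `𝒜_t(G)` to norm at most `1`, whereas at least half of the
pairs keep norm at least `R / t`.

Graphs (`exists_expander_with_large_distances`). Take the Cayley graph of `F ^ l` whose steps are
the multiples of the points of the moment curve. A nontrivial character is trivial on fewer than `l`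
of these lines, by Vandermonde, which gives the gap; counting words gives the distances. A lazy
blow-up then reaches every large `n`. -/

namespace SpectralCalculus

/-! ### Walks and Cesàro averages -/

namespace RegularMultigraph

theorem isSymmStochastic_normAdj {V : Type*} [Fintype V] (G : RegularMultigraph V) :
    IsSymmStochastic G.normAdj := by
  have hd : (0 : ℝ) < G.degree := by exact_mod_cast G.degree_pos
  refine ⟨?_, fun i j => by simp only [normAdj, Matrix.of_apply]; positivity, fun i => ?_⟩
  · ext i j
    simp [normAdj, G.symm i j]
  · simp only [normAdj, Matrix.of_apply]
    rw [← Finset.sum_div, ← Nat.cast_sum, G.sum_mult, div_self hd.ne']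

variable {V : Type*} [Fintype V] [DecidableEq V]

theorem normAdj_pow_apply (G : RegularMultigraph V) (s : ℕ) (u v : V) :
    (G.normAdj ^ s) u v = (G.walkCount s u v : ℝ) / (G.degree : ℝ) ^ s := by
  have hd : (G.degree : ℝ) ≠ 0 := by exact_mod_cast G.degree_pos.ne'
  induction s generalizing u v with
  | zero => simp [walkCount, Matrix.one_apply]
  | succ s ih =>
    simp only [pow_succ' G.normAdj, Matrix.mul_apply, ih, walkCount, Nat.cast_sum, Nat.cast_mul,
      Finset.sum_div]
    refine Finset.sum_congr rfl fun w _ => ?_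
    simp only [normAdj, Matrix.of_apply]
    rw [div_mul_div_comm, pow_succ']

theorem normAdj_cesaro (G : RegularMultigraph V) (m : ℕ) (hm : 1 ≤ m) :
    (G.cesaro m hm).normAdj = matrixCesaro m G.normAdj := by
  have hd : (G.degree : ℝ) ≠ 0 := by exact_mod_cast G.degree_pos.ne'
  have hm' : (m : ℝ) ≠ 0 := by positivity
  ext u v
  simp only [matrixCesaro, Matrix.smul_apply, Matrix.sum_apply, normAdj_pow_apply, smul_eq_mul]
  simp only [normAdj, cesaro, Matrix.of_apply]
  push_cast
  rw [Finset.sum_div, Finset.mul_sum]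
  refine Finset.sum_congr rfl fun s hs => ?_
  have h : (G.degree : ℝ) ^ (m - 1) = (G.degree : ℝ) ^ (m - 1 - s) * (G.degree : ℝ) ^ s := by
    rw [← pow_add]
    congr 1
    have := Finset.mem_range.mp hs
    omega
  rw [h]
  field_simp

theorem abs_sub_le_of_walkCount_ne_zero (G : RegularMultigraph V) (g : V → ℤ)
    (hg : ∀ u v, G.mult u v ≠ 0 → |g u - g v| ≤ 1) (s : ℕ) (u v : V)
    (h : G.walkCount s u v ≠ 0) : |g u - g v| ≤ s := by
  induction s generalizing u with
  | zero =>
    have : u = v := by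
      by_contra hne
      simp [walkCount, hne] at h
    simp [this]
  | succ s ih =>
    obtain ⟨w, -, hw⟩ := Finset.exists_ne_zero_of_sum_ne_zero h
    have h1 := hg u w (left_ne_zero_of_mul hw)
    have h2 := ih w (right_ne_zero_of_mul hw)
    have h3 := abs_sub_le (g u) (g w) (g v)
    push_cast
    linarith

theorem abs_sub_le_of_cesaro_mult_ne_zero (G : RegularMultigraph V) (g : V → ℤ)
    (hg : ∀ u v, G.mult u v ≠ 0 → |g u - g v| ≤ 1) (m : ℕ) (hm : 1 ≤ m) (u v : V)
    (h : (G.cesaro m hm).mult u v ≠ 0) : |g u - g v| ≤ m := by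
  simp only [cesaro] at h
  obtain ⟨s, hs, hw⟩ := Finset.exists_ne_zero_of_sum_ne_zero h
  have h1 := G.abs_sub_le_of_walkCount_ne_zero g hg s u v (right_ne_zero_of_mul hw)
  have h2 : (s : ℤ) < m := by exact_mod_cast Finset.mem_range.mp hs
  linarith

end RegularMultigraph

/-! ### From slow decay to the failure of uniform decay -/

theorem not_uniformDecay_of_cesaro_lower_bound {X : Type*} (K : X → X → ℝ≥0) (η : ℝ) (hη : 0 < η)
    (G : (n : ℕ) → RegularMultigraph (Fin n))
    (hfin : ∀ n : ℕ, 1 ≤ n → (G n).gammaPlus K < ⊤)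
    (hlim : Tendsto (fun n : ℕ => (G n).gammaPlus K) atTop (𝓝 ⊤))
    (hces : ∀ (t : ℕ) (ht : 1 ≤ t), ∃ n₀ : ℕ, ∀ n : ℕ, n₀ ≤ n →
      ENNReal.ofReal η * (G n).gammaPlus K ≤ ((G n).cesaro t ht).gammaPlus K) :
    ¬ UniformDecay K := by
  intro hU
  -- This `M` satisfies `M > 1` and `η * M ≥ 2`, so `η * γ ≤ γ / M` is impossible for a finite
  -- positive `γ`.
  have hM : 1 < max 2 (2 / η) := lt_of_lt_of_le (by norm_num) (le_max_left _ _)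
  obtain ⟨t, ht, Γ, hΓ, h⟩ := hU (max 2 (2 / η)) hM
  obtain ⟨n₀, hn₀⟩ := hces t ht
  have hev : ∀ᶠ n in atTop, ENNReal.ofReal Γ < (G n).gammaPlus K :=
    hlim.eventually (lt_mem_nhds ENNReal.ofReal_lt_top)
  obtain ⟨n, hn, hn1, hn2⟩ :=
    (hev.and ((eventually_ge_atTop 1).and (eventually_ge_atTop n₀))).exists
  have h1 := h n hn1 (G n).normAdj (G n).isSymmStochastic_normAdj hn.le
  have h2 := hn₀ n hn2
  unfold RegularMultigraph.gammaPlus at h2 hn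
  rw [RegularMultigraph.normAdj_cesaro] at h2
  have h3 := h2.trans h1
  have hpos : gammaPlus (G n).normAdj K ≠ 0 := (lt_of_le_of_lt zero_le hn).ne'
  have htop : gammaPlus (G n).normAdj K ≠ ⊤ := (hfin n hn1).ne
  obtain ⟨r, hr⟩ : ∃ r, r = (gammaPlus (G n).normAdj K).toReal := ⟨_, rfl⟩
  have hr0 : 0 < r := hr ▸ ENNReal.toReal_pos hpos htop
  have hre : gammaPlus (G n).normAdj K = ENNReal.ofReal r := by
    rw [hr, ENNReal.ofReal_toReal htop]
  rw [hre, ← ENNReal.ofReal_mul hη.le, ← ENNReal.ofReal_div_of_pos (by linarith),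
    ENNReal.ofReal_le_ofReal_iff (by positivity), le_div_iff₀ (by linarith)] at h3
  have h4 : 2 ≤ η * max 2 (2 / η) := by
    calc (2 : ℝ) = η * (2 / η) := by field_simp
      _ ≤ _ := mul_le_mul_of_nonneg_left (le_max_right _ _) hη.le
  nlinarith

/-- The Poincaré inequality for real functions with constant `κ`. -/
def HasRealGap {V : Type*} [Fintype V] (A : Matrix V V ℝ) (κ : ℝ) : Prop :=
  ∀ f : V → ℝ, ∑ i, ∑ j, (f i - f j) ^ 2 ≤
    κ * Fintype.card V * ∑ i, ∑ j, A i j * (f i - f j) ^ 2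

/-! ### Vertex expansion that survives the loss of a few edges -/

section Expansion

variable {V : Type*} [Fintype V] [DecidableEq V]

theorem sum_mul_sq_indicator_sub (a : V → V → ℝ) (ha : ∀ i j, a i j = a j i) (S : Finset V) :
    ∑ i, ∑ j, a i j * ((if i ∈ S then (1 : ℝ) else 0) - (if j ∈ S then 1 else 0)) ^ 2 =
      2 * ∑ i ∈ S, ∑ j ∈ Sᶜ, a i j := by
  have h1 : ∀ i j, a i j * ((if i ∈ S then (1 : ℝ) else 0) - (if j ∈ S then 1 else 0)) ^ 2 =
      (if i ∈ S then (if j ∈ Sᶜ then a i j else 0) else 0) +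
      (if j ∈ S then (if i ∈ Sᶜ then a j i else 0) else 0) := by
    intro i j
    rw [ha j i]
    by_cases hi : i ∈ S <;> by_cases hj : j ∈ S <;> simp [hi, hj]
  have h2 : ∑ i, ∑ j, (if i ∈ S then (if j ∈ Sᶜ then a i j else 0) else 0) =
      ∑ i ∈ S, ∑ j ∈ Sᶜ, a i j := by
    rw [← Finset.sum_filter_add_sum_filter_not Finset.univ (· ∈ S)]
    rw [Finset.filter_mem_eq_inter, Finset.univ_inter]
    have hz : ∑ i ∈ Finset.univ.filter (fun i => ¬ i ∈ S),
        ∑ j, (if i ∈ S then (if j ∈ Sᶜ then a i j else 0) else 0) = 0 := by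
      refine Finset.sum_eq_zero fun i hi => ?_
      simp [(Finset.mem_filter.mp hi).2]
    rw [hz, add_zero]
    refine Finset.sum_congr rfl fun i hi => ?_
    simp only [hi, if_true]
    rw [← Finset.sum_filter, Finset.filter_mem_eq_inter, Finset.univ_inter]
  simp only [h1, Finset.sum_add_distrib]
  have h3 : ∑ i, ∑ j, (if j ∈ S then (if i ∈ Sᶜ then a j i else 0) else 0) =
      ∑ i ∈ S, ∑ j ∈ Sᶜ, a i j := by
    rw [Finset.sum_comm]
    exact h2
  rw [h2, h3]
  ring

/-- The gap inequality is tested on the indicator of `S`, whose complement has at least half of the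
points. -/
theorem HasRealGap.card_le_cut {A : Matrix V V ℝ} {κ : ℝ} (hκ : 0 ≤ κ) (hgap : HasRealGap A κ)
    (hA : IsSymmStochastic A) (S : Finset V) (hS : 2 * (S.card : ℝ) ≤ Fintype.card V) :
    (S.card : ℝ) ≤ 2 * κ * ∑ i ∈ S, ∑ j ∈ Sᶜ, A i j := by
  have h := hgap fun i => if i ∈ S then (1 : ℝ) else 0
  have h1 := sum_mul_sq_indicator_sub (fun _ _ => (1 : ℝ)) (fun _ _ => rfl) S
  simp only [one_mul] at h1
  rw [h1, sum_mul_sq_indicator_sub A (fun i j => hA.1.apply j i) S] at h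
  simp only [Finset.sum_const, nsmul_eq_mul, mul_one] at h
  have hc : ((Sᶜ).card : ℝ) = Fintype.card V - S.card := by
    rw [Finset.card_compl, Nat.cast_sub (Finset.card_le_univ S)]
  rw [hc] at h
  have hcut : 0 ≤ ∑ i ∈ S, ∑ j ∈ Sᶜ, A i j :=
    Finset.sum_nonneg fun i _ => Finset.sum_nonneg fun j _ => hA.2.1 i j
  set c := ∑ i ∈ S, ∑ j ∈ Sᶜ, A i j
  have hs : (0 : ℝ) ≤ S.card := by positivity
  rcases hs.eq_or_lt with h0 | h0
  · rw [← h0]; positivity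
  · have hn : (0 : ℝ) < Fintype.card V := by linarith
    have : (S.card : ℝ) * Fintype.card V ≤ (2 * κ * c) * Fintype.card V := by nlinarith
    exact le_of_mul_le_mul_right this hn

/-- Deleting a small part of the mass of an expander leaves a large set in which small sets
still expand. -/
theorem HasRealGap.exists_expanding_core [Nonempty V] {A : Matrix V V ℝ} {κ : ℝ} (hκ : 0 < κ)
    (hgap : HasRealGap A κ) (hA : IsSymmStochastic A) (g : V → V → Prop)
    [∀ i j, Decidable (g i j)]
    (hbad : 16 * κ * ∑ i, ∑ j, (if g i j then 0 else A i j) ≤ Fintype.card V) :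
    ∃ W : Finset V, W.Nonempty ∧ ∀ S ⊆ W, 4 * (S.card : ℝ) ≤ Fintype.card V →
      (S.card : ℝ) ≤ 4 * κ * ((W \ S).filter fun j => ∃ i ∈ S, g i j).card := by
  have hn : (0 : ℝ) < Fintype.card V := by exact_mod_cast Fintype.card_pos
  let B : V → V → ℝ := fun i j => if g i j then A i j else 0
  have hB0 : ∀ i j, 0 ≤ B i j := fun i j => by
    simp only [B]; split_ifs <;> [exact hA.2.1 i j; exact le_rfl]
  let gb : Finset V → ℝ := fun S => ∑ i ∈ S, ∑ j ∈ Sᶜ, B i j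
  have hcut : ∀ S : Finset V, ∑ i ∈ S, ∑ j ∈ Sᶜ, A i j ≤
      gb S + ∑ i, ∑ j, (if g i j then 0 else A i j) := by
    intro S
    have h1 : ∑ i ∈ S, ∑ j ∈ Sᶜ, A i j =
        gb S + ∑ i ∈ S, ∑ j ∈ Sᶜ, (if g i j then 0 else A i j) := by
      simp only [gb, ← Finset.sum_add_distrib, B]
      refine Finset.sum_congr rfl fun i _ => Finset.sum_congr rfl fun j _ => ?_
      split_ifs <;> simp
    have h0 : ∀ i j, 0 ≤ (if g i j then 0 else A i j) := fun i j => by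
      split_ifs <;> [exact le_rfl; exact hA.2.1 i j]
    have h2 : ∑ i ∈ S, ∑ j ∈ Sᶜ, (if g i j then 0 else A i j) ≤
        ∑ i, ∑ j, (if g i j then 0 else A i j) := by
      refine (Finset.sum_le_sum fun i _ => Finset.sum_le_sum_of_subset_of_nonneg
        (Finset.subset_univ _) fun j _ _ => h0 i j).trans ?_
      exact Finset.sum_le_sum_of_subset_of_nonneg (Finset.subset_univ _)
        fun i _ _ => Finset.sum_nonneg fun j _ => h0 i j
    linarith
  -- A largest set `U` with few good edges leaving it is removed. A badly expanding set outside `U`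
  -- could be added to it, against maximality.
  let F : Finset (Finset V) := Finset.univ.filter fun S =>
    2 * (S.card : ℝ) ≤ Fintype.card V ∧ 4 * κ * gb S ≤ S.card
  have hF : F.Nonempty := ⟨∅, by simp [F, gb]⟩
  obtain ⟨U, hUF, hUmax⟩ := F.exists_max_image Finset.card hF
  obtain ⟨hU1, hU2⟩ := (Finset.mem_filter.mp hUF).2
  -- The cut bound gives `|U| ≤ 2κ(gb U + bad) ≤ |U| / 2 + |V| / 8`. Hence adding at most a quarter
  -- of the points to `U` stays within the bound of one half in `F`.
  have hUsmall : 4 * (U.card : ℝ) ≤ Fintype.card V := by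
    have h1 := hgap.card_le_cut hκ.le hA U hU1
    have h2 := hcut U
    nlinarith
  refine ⟨Uᶜ, ?_, ?_⟩
  · rw [← Finset.card_pos, Finset.card_compl]
    have : U.card < Fintype.card V := by
      have : (U.card : ℝ) < Fintype.card V := by linarith
      exact_mod_cast this
    omega
  · intro S hS hS4
    rcases S.eq_empty_or_nonempty with rfl | hSne
    · simp
    have hdisj : Disjoint U S := by
      rw [Finset.disjoint_left]
      intro a ha ha'
      exact (Finset.mem_compl.mp (hS ha')) ha
    have hcard : (U ∪ S).card = U.card + S.card := Finset.card_union_of_disjoint hdisj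
    have hnot : U ∪ S ∉ F := by
      intro hmem
      have := hUmax _ hmem
      have := hSne.card_pos
      omega
    have hgt : ((U.card : ℝ) + S.card) < 4 * κ * gb (U ∪ S) := by
      by_contra hle
      push Not at hle
      apply hnot
      simp only [F, Finset.mem_filter, Finset.mem_univ, true_and, hcard]
      push_cast
      exact ⟨by linarith, hle⟩
    have hsplit : gb (U ∪ S) ≤ gb U + ∑ i ∈ S, ∑ j ∈ (U ∪ S)ᶜ, B i j := by
      simp only [gb]
      rw [Finset.sum_union hdisj]
      gcongr with i hi
      · exact fun _ _ _ => hB0 _ _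
      · exact Finset.subset_union_left
    set Nb := (Uᶜ \ S).filter fun j => ∃ i ∈ S, g i j with hNb
    -- Each point of `Nb` receives mass at most `1`, so mass is bounded by a number of points.
    have hnb : ∑ i ∈ S, ∑ j ∈ (U ∪ S)ᶜ, B i j ≤ Nb.card := by
      rw [Finset.sum_comm]
      have h1 : ∑ j ∈ (U ∪ S)ᶜ, ∑ i ∈ S, B i j = ∑ j ∈ Nb, ∑ i ∈ S, B i j := by
        symm
        apply Finset.sum_subset
        · intro j hj
          simp only [hNb, Finset.mem_filter, Finset.mem_sdiff, Finset.mem_compl] at hj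
          simp only [Finset.mem_compl, Finset.mem_union]
          tauto
        · intro j hj hj'
          refine Finset.sum_eq_zero fun i hi => ?_
          simp only [hNb, Finset.mem_filter, Finset.mem_sdiff, Finset.mem_compl] at hj'
          simp only [Finset.mem_compl, Finset.mem_union] at hj
          have : ¬ g i j := fun hg => hj' ⟨⟨by tauto, by tauto⟩, i, hi, hg⟩
          simp [B, this]
      rw [h1]
      calc ∑ j ∈ Nb, ∑ i ∈ S, B i j ≤ ∑ j ∈ Nb, (1 : ℝ) := by
            refine Finset.sum_le_sum fun j _ => ?_
            calc ∑ i ∈ S, B i j ≤ ∑ i, B i j :=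
                  Finset.sum_le_sum_of_subset_of_nonneg (Finset.subset_univ _) fun i _ _ => hB0 i j
              _ ≤ ∑ i, A j i := by
                  refine Finset.sum_le_sum fun i _ => ?_
                  rw [hA.1.apply i j]
                  simp only [B]
                  split_ifs <;> [exact le_rfl; exact hA.2.1 i j]
              _ = 1 := hA.2.2 j
        _ = Nb.card := by simp
    nlinarith

/-- In an expander, most edges of which have length at most `T` for a pseudometric `N`, some ball
of radius logarithmically many times `T` contains a quarter of the points. -/
theorem HasRealGap.exists_large_ball [Nonempty V] {A : Matrix V V ℝ} {κ : ℝ} (hκ : 0 < κ)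
    (hgap : HasRealGap A κ) (hA : IsSymmStochastic A) (N : V → V → ℝ)
    (hN0 : ∀ i, N i i = 0) (hNt : ∀ i j k, N i k ≤ N i j + N j k) (T : ℝ) (hT : 0 ≤ T)
    [∀ i j, Decidable (N i j ≤ T)]
    (hbad : 16 * κ * ∑ i, ∑ j, (if N i j ≤ T then 0 else A i j) ≤ Fintype.card V)
    (D : ℕ) (hD : (Fintype.card V : ℝ) < (1 + 1 / (4 * κ)) ^ D) :
    ∃ w : V, ∃ H : Finset V, (∀ i ∈ H, N w i ≤ D * T) ∧
      (Fintype.card V : ℝ) ≤ 4 * H.card := by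
  obtain ⟨W, ⟨w, hw⟩, hW⟩ := hgap.exists_expanding_core hκ hA (fun i j => N i j ≤ T) hbad
  by_contra hcon
  push Not at hcon
  -- The ball around `w` inside the core grows by the factor `1 + 1 / (4κ)` at each step while it
  -- has less than a quarter of the points; after `D` steps it would exceed `V`.
  have hgrow : ∀ s : ℕ, s ≤ D → ∃ H ⊆ W, (∀ i ∈ H, N w i ≤ s * T) ∧
      (1 + 1 / (4 * κ)) ^ s ≤ H.card := by
    intro s
    induction s with
    | zero => exact fun _ => ⟨{w}, by simpa using hw, by simp [hN0], by simp⟩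
    | succ s ih =>
      intro hs
      obtain ⟨H, hHW, hH, hHc⟩ := ih (by omega)
      by_cases hbig : (Fintype.card V : ℝ) ≤ 4 * H.card
      · exfalso
        refine absurd hbig (not_le.mpr (hcon w H fun i hi => (hH i hi).trans ?_))
        gcongr
        omega
      · push Not at hbig
        set Nb := (W \ H).filter fun j => ∃ i ∈ H, N i j ≤ T with hNb
        have hexp := hW H hHW hbig.le
        refine ⟨H ∪ Nb, ?_, ?_, ?_⟩
        · refine Finset.union_subset hHW fun j hj => ?_
          exact (Finset.mem_sdiff.mp (Finset.mem_filter.mp hj).1).1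
        · intro i hi
          push_cast
          rcases Finset.mem_union.mp hi with hi | hi
          · linarith [hH i hi]
          · obtain ⟨-, k, hk, hki⟩ := Finset.mem_filter.mp hi
            linarith [hH k hk, hNt w k i]
        · have hdisj : Disjoint H Nb := by
            rw [Finset.disjoint_left]
            intro a ha ha'
            exact (Finset.mem_sdiff.mp (Finset.mem_filter.mp ha').1).2 ha
          rw [Finset.card_union_of_disjoint hdisj, pow_succ]
          push_cast
          have h1 : (H.card : ℝ) / (4 * κ) ≤ Nb.card := by
            rw [div_le_iff₀ (by positivity)]
            linarith
          calc (1 + 1 / (4 * κ)) ^ s * (1 + 1 / (4 * κ))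
              ≤ H.card * (1 + 1 / (4 * κ)) := by gcongr
            _ = H.card + H.card / (4 * κ) := by ring
            _ ≤ _ := by linarith
  obtain ⟨H, -, -, hHc⟩ := hgrow D le_rfl
  have : (H.card : ℝ) ≤ Fintype.card V := by exact_mod_cast Finset.card_le_univ H
  linarith

end Expansion

/-! ### Upper bound for Poincaré constants of expanders in the sequence space -/

theorem IntSeq.dist_eq (x y : IntSeq) : dist x y = Real.log (1 + ‖x.toLp - y.toLp‖) := rfl

theorem IntSeq.norm_sub_eq_zero_of_lt_one (x y : IntSeq) (h : ‖x.toLp - y.toLp‖ < 1) :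
    ‖x.toLp - y.toLp‖ = 0 := by
  have h0 : x.toLp = y.toLp := by
    ext i
    obtain ⟨a, ha⟩ := x.isInt i
    obtain ⟨b, hb⟩ := y.isInt i
    have h1 := lp.norm_apply_le_norm ENNReal.top_ne_zero (x.toLp - y.toLp) i
    rw [lp.coeFn_sub, Pi.sub_apply, ha, hb, Real.norm_eq_abs] at h1
    have h2 : |(a : ℝ) - b| < 1 := lt_of_le_of_lt h1 h
    have h3 : |a - b| < 1 := by exact_mod_cast h2
    rw [ha, hb, sub_eq_zero.mp (Int.abs_lt_one_iff.mp h3)]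
  rw [h0, sub_self, norm_zero]

section Upper

variable {V : Type*} [Fintype V]

/-- Each `f i ^ 2` occurs at least `|H|` times in the double sum, through the pairs `(i, j)` with `j
∈ H`. -/
theorem HasRealGap.sum_sq_le_of_eqOn_zero [Nonempty V] {A : Matrix V V ℝ} {κ : ℝ}
    (hgap : HasRealGap A κ) (f : V → ℝ) (H : Finset V) (hf : ∀ i ∈ H, f i = 0)
    (hH : (Fintype.card V : ℝ) ≤ 4 * H.card) :
    ∑ i, f i ^ 2 ≤ 4 * κ * ∑ i, ∑ j, A i j * (f i - f j) ^ 2 := by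
  have hn : (0 : ℝ) < Fintype.card V := by exact_mod_cast Fintype.card_pos
  have h1 : ∑ i, H.card * f i ^ 2 ≤ ∑ i, ∑ j, (f i - f j) ^ 2 := by
    refine Finset.sum_le_sum fun i _ => ?_
    calc (H.card : ℝ) * f i ^ 2 = ∑ j ∈ H, (f i - f j) ^ 2 := by
          rw [Finset.sum_congr rfl fun j hj => by rw [hf j hj, sub_zero]]
          simp
      _ ≤ _ := Finset.sum_le_sum_of_subset_of_nonneg (Finset.subset_univ _)
          fun _ _ _ => sq_nonneg _
  rw [← Finset.mul_sum] at h1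
  have h2 := h1.trans (hgap f)
  have h3 : 0 ≤ ∑ i, f i ^ 2 := Finset.sum_nonneg fun i _ => sq_nonneg _
  set E := ∑ i, ∑ j, A i j * (f i - f j) ^ 2
  have : (Fintype.card V : ℝ) * ∑ i, f i ^ 2 ≤ Fintype.card V * (4 * κ * E) := by nlinarith
  exact le_of_mul_le_mul_left this hn

theorem IsSymmStochastic.sum_sum_mul_left {A : Matrix V V ℝ} (hA : IsSymmStochastic A)
    (f : V → ℝ) : ∑ i, ∑ j, A i j * f i = ∑ i, f i := by
  simp [← Finset.sum_mul, hA.2.2]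

theorem IsSymmStochastic.sum_sum_mul_right {A : Matrix V V ℝ} (hA : IsSymmStochastic A)
    (f : V → ℝ) : ∑ i, ∑ j, A i j * f j = ∑ i, f i := by
  rw [Finset.sum_comm, ← hA.sum_sum_mul_left f]
  exact Finset.sum_congr rfl fun i _ => Finset.sum_congr rfl fun j _ => by rw [hA.1.apply]

/-- The additive error `log (1 + D)` is absorbed into a multiple of `τ`, which is possible only
because `τ` is bounded below. -/
theorem log_one_add_mul_le (D τ : ℝ) (hD : 0 ≤ D) (hτ : Real.log 2 ≤ τ) :
    Real.log (1 + D * (Real.exp τ - 1)) ≤ (Real.log (1 + D) / Real.log 2 + 1) * τ := by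
  have h2 : 0 < Real.log 2 := Real.log_pos (by norm_num)
  have he : 1 ≤ Real.exp τ := Real.one_le_exp (h2.le.trans hτ)
  have hl : 0 ≤ Real.log (1 + D) := Real.log_nonneg (by linarith)
  calc Real.log (1 + D * (Real.exp τ - 1)) ≤ Real.log ((1 + D) * Real.exp τ) := by
        apply Real.log_le_log
        · nlinarith
        · nlinarith
    _ = Real.log (1 + D) + τ := by
        rw [Real.log_mul (by positivity) (by positivity), Real.log_exp]
    _ ≤ Real.log (1 + D) / Real.log 2 * τ + τ := by
        gcongr
        rw [div_mul_eq_mul_div, le_div_iff₀ h2]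
        gcongr
    _ = _ := by ring

theorem HasRealGap.sum_dist_sq_le [Nonempty V] {A : Matrix V V ℝ} {κ : ℝ} (hκ : 0 < κ)
    (hgap : HasRealGap A κ) (hA : IsSymmStochastic A)
    (D : ℕ) (hD : (Fintype.card V : ℝ) < (1 + 1 / (4 * κ)) ^ D) (x : V → IntSeq) :
    ∑ i, ∑ j, dist (x i) (x j) ^ 2 ≤ 160 * κ * (Real.log (1 + D) / Real.log 2 + 1) ^ 2 *
      Fintype.card V * ∑ i, ∑ j, A i j * dist (x i) (x j) ^ 2 := by
  classical
  have hn : (0 : ℝ) < Fintype.card V := by exact_mod_cast Fintype.card_pos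
  have h2 : 0 < Real.log 2 := Real.log_pos (by norm_num)
  set n : ℝ := ((Fintype.card V : ℕ) : ℝ) with hn_def
  set E := ∑ i, ∑ j, A i j * dist (x i) (x j) ^ 2 with hE
  have hE0 : 0 ≤ E := Finset.sum_nonneg fun i _ => Finset.sum_nonneg fun j _ =>
    mul_nonneg (hA.2.1 i j) (sq_nonneg _)
  set L := Real.log (1 + D) / Real.log 2 + 1 with hL
  have hL1 : 1 ≤ L := by
    have : 0 ≤ Real.log (1 + D) := Real.log_nonneg (by simp)
    have : 0 ≤ Real.log (1 + D) / Real.log 2 := by positivity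
    linarith
  -- With this `τ`, Chebyshev bounds the mass of the edges longer than `τ` by `n / (16κ)`, the loss
  -- that the expanding core tolerates.
  set τ := Real.sqrt (16 * κ * E / n) with hτ
  have hτ0 : 0 ≤ τ := Real.sqrt_nonneg _
  have hτ2 : τ ^ 2 = 16 * κ * E / n := Real.sq_sqrt (by positivity)
  -- Norms below `1` vanish by integrality. This covers `τ < log 2`, where `log_one_add_mul_le` is
  -- not available.
  let T : ℝ := if τ < Real.log 2 then 0 else Real.exp τ - 1
  have hT0 : 0 ≤ T := by
    simp only [T]
    split_ifs
    · exact le_rfl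
    · linarith [Real.one_le_exp hτ0]
  have hgood : ∀ i j, dist (x i) (x j) ≤ τ → ‖(x i).toLp - (x j).toLp‖ ≤ T := by
    intro i j hij
    rw [IntSeq.dist_eq, Real.log_le_iff_le_exp (by positivity)] at hij
    simp only [T]
    split_ifs with hlt
    · refine (IntSeq.norm_sub_eq_zero_of_lt_one _ _ ?_).le
      have : Real.exp τ < 2 := by
        rw [← Real.exp_log (by norm_num : (0 : ℝ) < 2)]
        exact Real.exp_lt_exp.mpr hlt
      linarith
    · linarith
  have hbad : 16 * κ * ∑ i, ∑ j, (if ‖(x i).toLp - (x j).toLp‖ ≤ T then 0 else A i j) ≤ n := by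
    -- If `E = 0` then `τ = 0` and Chebyshev is void, but every edge of positive weight has length
    -- `0`.
    rcases hE0.eq_or_lt with hE0 | hE0
    · have hz : ∀ i j, A i j * dist (x i) (x j) ^ 2 = 0 := by
        intro i j
        have h1 := (Finset.sum_eq_zero_iff_of_nonneg (fun i _ => Finset.sum_nonneg fun j _ =>
          mul_nonneg (hA.2.1 i j) (sq_nonneg (dist (x i) (x j))))).mp hE0.symm i (Finset.mem_univ i)
        exact (Finset.sum_eq_zero_iff_of_nonneg (fun j _ =>
          mul_nonneg (hA.2.1 i j) (sq_nonneg (dist (x i) (x j))))).mp h1 j (Finset.mem_univ j)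
      rw [Finset.sum_eq_zero, mul_zero]
      · exact hn.le
      · refine fun i _ => Finset.sum_eq_zero fun j _ => ?_
        split_ifs with h
        · rfl
        · rcases mul_eq_zero.mp (hz i j) with h0 | h0
          · exact h0
          · refine absurd (hgood i j ?_) h
            rw [pow_eq_zero_iff two_ne_zero] at h0
            rw [h0]
            exact hτ0
    · have hpt : ∀ i j, τ ^ 2 * (if ‖(x i).toLp - (x j).toLp‖ ≤ T then 0 else A i j) ≤
          A i j * dist (x i) (x j) ^ 2 := by
        intro i j
        split_ifs with h
        · rw [mul_zero]
          exact mul_nonneg (hA.2.1 i j) (sq_nonneg _)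
        · have hlt : τ < dist (x i) (x j) := by
            by_contra hle
            exact h (hgood i j (not_lt.mp hle))
          rw [mul_comm]
          exact mul_le_mul_of_nonneg_left (pow_le_pow_left₀ hτ0 hlt.le 2) (hA.2.1 i j)
      have hsum : τ ^ 2 * ∑ i, ∑ j, (if ‖(x i).toLp - (x j).toLp‖ ≤ T then 0 else A i j) ≤ E := by
        rw [Finset.mul_sum]
        refine Finset.sum_le_sum fun i _ => ?_
        rw [Finset.mul_sum]
        exact Finset.sum_le_sum fun j _ => hpt i j
      rw [hτ2, div_mul_eq_mul_div, div_le_iff₀ hn] at hsum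
      nlinarith
  obtain ⟨w, H, hH, hHc⟩ := hgap.exists_large_ball hκ hA
    (fun i j => ‖(x i).toLp - (x j).toLp‖) (fun i => by simp)
    (fun i j k => norm_sub_le_norm_sub_add_norm_sub _ _ _) T hT0 hbad D hD
  set R := L * τ with hR
  have hRH : ∀ i ∈ H, dist (x i) (x w) ≤ R := by
    intro i hi
    have h1 := hH i hi
    rw [dist_comm, IntSeq.dist_eq]
    refine (Real.log_le_log (by positivity) (by linarith : _ ≤ 1 + D * T)).trans ?_
    simp only [T]
    split_ifs with hlt
    · simp only [mul_zero, add_zero, Real.log_one]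
      positivity
    · exact log_one_add_mul_le D τ (by positivity) (not_lt.mp hlt)
  have hR0 : 0 ≤ R := by positivity
  -- The excess over the radius vanishes on `H` and is `1`-Lipschitz in `x i`, so its energy is at
  -- most `E`.
  let f : V → ℝ := fun i => max 0 (dist (x i) (x w) - R)
  have hf := hgap.sum_sq_le_of_eqOn_zero f H
    (fun i hi => max_eq_left (by linarith [hRH i hi])) hHc
  have hfE : ∑ i, ∑ j, A i j * (f i - f j) ^ 2 ≤ E := by
    refine Finset.sum_le_sum fun i _ => Finset.sum_le_sum fun j _ =>
      mul_le_mul_of_nonneg_left ?_ (hA.2.1 i j)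
    rw [← sq_abs]
    refine pow_le_pow_left₀ (abs_nonneg _) ?_ 2
    refine (abs_max_sub_max_le_max _ _ _ _).trans ?_
    rw [sub_self, abs_zero, sub_sub_sub_cancel_right, max_eq_right (abs_nonneg _)]
    exact abs_dist_sub_le _ _ _
  have hpt : ∀ i j, dist (x i) (x j) ^ 2 ≤ (8 * R ^ 2 + 4 * f i ^ 2) + 4 * f j ^ 2 := by
    intro i j
    have h1 : dist (x i) (x w) ≤ R + f i := by linarith [le_max_right 0 (dist (x i) (x w) - R)]
    have h3 : dist (x j) (x w) ≤ R + f j := by linarith [le_max_right 0 (dist (x j) (x w) - R)]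
    have h4 := dist_triangle_right (x i) (x j) (x w)
    calc dist (x i) (x j) ^ 2 ≤ (2 * R + f i + f j) ^ 2 :=
          pow_le_pow_left₀ dist_nonneg (by linarith) 2
      _ ≤ _ := by nlinarith [sq_nonneg (2 * R - f i - f j), sq_nonneg (f i - f j)]
  have htot : ∑ i, ∑ j, dist (x i) (x j) ^ 2 ≤ 8 * n ^ 2 * R ^ 2 + 8 * n * ∑ i, f i ^ 2 := by
    refine (Finset.sum_le_sum fun i _ => Finset.sum_le_sum fun j _ => hpt i j).trans_eq ?_
    simp only [Finset.sum_add_distrib, Finset.sum_const, Finset.card_univ, nsmul_eq_mul,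
      ← Finset.mul_sum]
    ring
  have hR2 : n * R ^ 2 = L ^ 2 * (16 * κ * E) := by
    rw [hR, mul_pow, hτ2]
    field_simp
  have hf2 : ∑ i, f i ^ 2 ≤ 4 * κ * E :=
    hf.trans (mul_le_mul_of_nonneg_left hfE (by positivity))
  calc ∑ i, ∑ j, dist (x i) (x j) ^ 2 ≤ 8 * n ^ 2 * R ^ 2 + 8 * n * ∑ i, f i ^ 2 := htot
    _ = 8 * n * (n * R ^ 2) + 8 * n * ∑ i, f i ^ 2 := by ring
    _ ≤ 8 * n * (L ^ 2 * (16 * κ * E)) + 8 * n * (1 * (4 * κ * E)) := by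
        rw [hR2, one_mul]; gcongr
    _ ≤ 8 * n * (L ^ 2 * (16 * κ * E)) + 8 * n * (L ^ 2 * (4 * κ * E)) := by
        gcongr
        nlinarith
    _ = _ := by ring

/-- The diagonal weights control `∑ dist (x i) (y i) ^ 2`, so `y` can be exchanged for `x` on both
sides at the cost of constants. -/
theorem HasRealGap.sum_dist_sq_le_of_lazy [Nonempty V] {A : Matrix V V ℝ} {κ : ℝ} (hκ : 1 ≤ κ)
    (hgap : HasRealGap A κ) (hA : IsSymmStochastic A) (hlazy : ∀ i, 1 / 2 ≤ A i i)
    (D : ℕ) (hD : (Fintype.card V : ℝ) < (1 + 1 / (4 * κ)) ^ D) (x y : V → IntSeq) :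
    ∑ i, ∑ j, dist (x i) (y j) ^ 2 ≤ 2000 * κ * (Real.log (1 + D) / Real.log 2 + 1) ^ 2 *
      Fintype.card V * ∑ i, ∑ j, A i j * dist (x i) (y j) ^ 2 := by
  classical
  have h := hgap.sum_dist_sq_le (by linarith) hA D hD x
  have hn : (0 : ℝ) < Fintype.card V := by exact_mod_cast Fintype.card_pos
  have h2 : 0 < Real.log 2 := Real.log_pos (by norm_num)
  set n : ℝ := ((Fintype.card V : ℕ) : ℝ) with hn_def
  set L := Real.log (1 + D) / Real.log 2 + 1 with hL
  have hL1 : 1 ≤ L := by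
    have : 0 ≤ Real.log (1 + D) := Real.log_nonneg (by simp)
    have : 0 ≤ Real.log (1 + D) / Real.log 2 := by positivity
    linarith
  set E := ∑ i, ∑ j, A i j * dist (x i) (y j) ^ 2 with hE
  set S := ∑ i, dist (x i) (y i) ^ 2 with hS
  have hS0 : 0 ≤ S := Finset.sum_nonneg fun i _ => sq_nonneg _
  have hSE : S ≤ 2 * E := by
    rw [hS, hE, Finset.mul_sum]
    refine Finset.sum_le_sum fun i _ => ?_
    have h1 : A i i * dist (x i) (y i) ^ 2 ≤ ∑ j, A i j * dist (x i) (y j) ^ 2 :=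
      Finset.single_le_sum (f := fun j => A i j * dist (x i) (y j) ^ 2)
        (fun j _ => mul_nonneg (hA.2.1 i j) (sq_nonneg _)) (Finset.mem_univ i)
    nlinarith [hlazy i, sq_nonneg (dist (x i) (y i))]
  have htri : ∀ a b c : IntSeq, dist a c ^ 2 ≤ 2 * dist a b ^ 2 + 2 * dist b c ^ 2 := by
    intro a b c
    calc dist a c ^ 2 ≤ (dist a b + dist b c) ^ 2 :=
          pow_le_pow_left₀ dist_nonneg (dist_triangle _ _ _) 2
      _ ≤ _ := by nlinarith [sq_nonneg (dist a b - dist b c)]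
  have hxx : ∑ i, ∑ j, A i j * dist (x i) (x j) ^ 2 ≤ 2 * E + 2 * S := by
    calc ∑ i, ∑ j, A i j * dist (x i) (x j) ^ 2
        ≤ ∑ i, ∑ j, (2 * (A i j * dist (x i) (y j) ^ 2) +
            2 * (A i j * dist (x j) (y j) ^ 2)) := by
          refine Finset.sum_le_sum fun i _ => Finset.sum_le_sum fun j _ => ?_
          have := mul_le_mul_of_nonneg_left (htri (x i) (y j) (x j)) (hA.2.1 i j)
          rw [dist_comm (y j)] at this
          linarith
      _ = 2 * E + 2 * S := by
          simp only [Finset.sum_add_distrib, ← Finset.mul_sum]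
          rw [hA.sum_sum_mul_right fun j => dist (x j) (y j) ^ 2]
  have hxy : ∑ i, ∑ j, dist (x i) (y j) ^ 2 ≤
      2 * ∑ i, ∑ j, dist (x i) (x j) ^ 2 + 2 * n * S := by
    refine (Finset.sum_le_sum fun i _ => Finset.sum_le_sum fun j _ =>
      htri (x i) (x j) (y j)).trans_eq ?_
    simp only [Finset.sum_add_distrib, Finset.sum_const, Finset.card_univ, nsmul_eq_mul,
      ← Finset.mul_sum]
    ring
  have hE0 : 0 ≤ E := by linarith
  have hc : 0 ≤ 160 * κ * L ^ 2 * n := by positivity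
  have h5 : 160 * κ * L ^ 2 * n * (∑ i, ∑ j, A i j * dist (x i) (x j) ^ 2) ≤
      160 * κ * L ^ 2 * n * (6 * E) := mul_le_mul_of_nonneg_left (by linarith) hc
  have h6 : 1 ≤ κ * L ^ 2 := by nlinarith
  have h7 : n * S ≤ n * (2 * E) := by gcongr
  have h8 : n * E ≤ κ * L ^ 2 * (n * E) := le_mul_of_one_le_left (by positivity) h6
  calc ∑ i, ∑ j, dist (x i) (y j) ^ 2
      ≤ 2 * (160 * κ * L ^ 2 * n * (6 * E)) + 2 * (n * (2 * E)) := by linarith [h.trans h5]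
    _ = 1920 * (κ * L ^ 2 * (n * E)) + 4 * (n * E) := by ring
    _ ≤ 2000 * (κ * L ^ 2 * (n * E)) := by nlinarith
    _ = _ := by ring

theorem HasRealGap.gammaPlus_le [Nonempty V] {A : Matrix V V ℝ} {κ : ℝ} (hκ : 1 ≤ κ)
    (hgap : HasRealGap A κ) (hA : IsSymmStochastic A) (hlazy : ∀ i, 1 / 2 ≤ A i i)
    (D : ℕ) (hD : (Fintype.card V : ℝ) < (1 + 1 / (4 * κ)) ^ D) :
    gammaPlus A (sqDist IntSeq) ≤
      ENNReal.ofReal (2000 * κ * (Real.log (1 + D) / Real.log 2 + 1) ^ 2) := by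
  have hn : (0 : ℝ) < Fintype.card V := by exact_mod_cast Fintype.card_pos
  have h2 : 0 < Real.log 2 := Real.log_pos (by norm_num)
  have h3 : 0 ≤ Real.log (1 + D) := Real.log_nonneg (by simp)
  refine iInf₂_le _ ⟨by positivity, fun x y => ?_⟩
  have h := hgap.sum_dist_sq_le_of_lazy hκ hA hlazy D hD x y
  simp only [sqDist, NNReal.coe_pow, coe_nndist]
  rw [one_div, inv_mul_le_iff₀ (by positivity)]
  refine h.trans_eq ?_
  field_simp

end Upper

/-! ### Lower bound by rounded Fréchet embeddings -/

/-- The finitely supported integer sequence with given initial entries. -/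
noncomputable def IntSeq.ofFin {n : ℕ} (c : Fin n → ℤ) : IntSeq where
  toLp := ⟨fun k => if h : k < n then (c ⟨k, h⟩ : ℝ) else 0, by
    refine memℓp_infty ⟨∑ k, |(c k : ℝ)|, ?_⟩
    rintro _ ⟨k, rfl⟩
    by_cases h : k < n
    · simp only [h, dif_pos, Real.norm_eq_abs]
      exact Finset.single_le_sum (f := fun k => |(c k : ℝ)|) (fun _ _ => abs_nonneg _)
        (Finset.mem_univ _)
    · simp only [h, dif_neg, not_false_eq_true, norm_zero]
      exact Finset.sum_nonneg fun _ _ => abs_nonneg _⟩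
  isInt k := by
    by_cases h : k < n
    · exact ⟨c ⟨k, h⟩, by simp [h]⟩
    · exact ⟨0, by simp [h]⟩

theorem IntSeq.ofFin_apply {n : ℕ} (c : Fin n → ℤ) (k : ℕ) :
    (IntSeq.ofFin c).toLp k = if h : k < n then (c ⟨k, h⟩ : ℝ) else 0 := rfl

theorem IntSeq.norm_ofFin_sub_le {n : ℕ} (c c' : Fin n → ℤ) (b : ℝ) (hb : 0 ≤ b)
    (h : ∀ k, |(c k : ℝ) - c' k| ≤ b) : ‖(ofFin c).toLp - (ofFin c').toLp‖ ≤ b := by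
  refine lp.norm_le_of_forall_le hb fun k => ?_
  rw [lp.coeFn_sub, Pi.sub_apply, ofFin_apply, ofFin_apply, Real.norm_eq_abs]
  by_cases hk : k < n
  · simpa [hk] using h ⟨k, hk⟩
  · simpa [hk] using hb

theorem IntSeq.abs_sub_le_norm_ofFin_sub {n : ℕ} (c c' : Fin n → ℤ) (k : Fin n) :
    |(c k : ℝ) - c' k| ≤ ‖(ofFin c).toLp - (ofFin c').toLp‖ := by
  have h := lp.norm_apply_le_norm ENNReal.top_ne_zero ((ofFin c).toLp - (ofFin c').toLp) (k : ℕ)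
  rw [lp.coeFn_sub, Pi.sub_apply, ofFin_apply, ofFin_apply, Real.norm_eq_abs] at h
  simpa using h

theorem abs_ceil_div_sub_le_one (a b t : ℤ) (ht : 0 < t) (h : |a - b| ≤ t) :
    |(⌈(a : ℝ) / t⌉ : ℝ) - ⌈(b : ℝ) / t⌉| ≤ 1 := by
  have key : ∀ a b : ℤ, a - b ≤ t → ⌈(a : ℝ) / t⌉ ≤ ⌈(b : ℝ) / t⌉ + 1 := by
    intro a b hab
    have ht' : (0 : ℝ) < t := by exact_mod_cast ht
    have hab' : (a : ℝ) - b ≤ t := by exact_mod_cast hab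
    rw [← Int.ceil_add_one]
    apply Int.ceil_le_ceil
    rw [div_add_one ht'.ne']
    gcongr
    linarith
  have h1 := key a b (le_of_abs_le h)
  have h2 := key b a (by linarith [neg_le_of_abs_le h])
  have : |⌈(a : ℝ) / t⌉ - ⌈(b : ℝ) / t⌉| ≤ 1 := abs_le.mpr ⟨by linarith, by linarith⟩
  exact_mod_cast this

/-- For the graph `G` itself `t = 1` is used; for its Cesàro average the same `g` serves, now with
Lipschitz constant `t`. -/
theorem RegularMultigraph.le_gammaPlus_of_lipschitz {n : ℕ} (hn : 1 ≤ n)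
    (G : RegularMultigraph (Fin n)) (g : Fin n → Fin n → ℤ) (t R : ℕ) (ht : 1 ≤ t)
    (hg : ∀ k u v, G.mult u v ≠ 0 → |g k u - g k v| ≤ t) (hg0 : ∀ k, g k k = 0)
    (hR : n ^ 2 ≤ 2 * (Finset.univ.filter fun p : Fin n × Fin n => (R : ℤ) ≤ g p.2 p.1).card) :
    ENNReal.ofReal ((Real.log (1 + R / t) / Real.log 2) ^ 2 / 2) ≤
      G.gammaPlus (sqDist IntSeq) := by
  have h2 : 0 < Real.log 2 := Real.log_pos (by norm_num)
  have hn' : (0 : ℝ) < n := by exact_mod_cast hn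
  have ht' : (0 : ℝ) < t := by exact_mod_cast ht
  refine le_iInf₂ fun c hc => ENNReal.ofReal_le_ofReal ?_
  obtain ⟨hc0, hc⟩ := hc
  -- Rounding keeps the values integral. Rounding up fixes `0` and does not decrease `R / t`, and
  -- edges still have norm at most `1`.
  let x : Fin n → IntSeq := fun u => IntSeq.ofFin fun k => ⌈(g k u : ℝ) / (t : ℤ)⌉
  have h := hc x x
  have hedge : ∀ u v, G.mult u v ≠ 0 → dist (x u) (x v) ≤ Real.log 2 := by
    intro u v huv
    rw [IntSeq.dist_eq]
    apply Real.log_le_log (by positivity)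
    have := IntSeq.norm_ofFin_sub_le (fun k => ⌈(g k u : ℝ) / (t : ℤ)⌉)
      (fun k => ⌈(g k v : ℝ) / (t : ℤ)⌉) 1 zero_le_one fun k =>
      abs_ceil_div_sub_le_one _ _ t (by exact_mod_cast ht) (hg k u v huv)
    linarith
  have hfar : ∀ u v, (R : ℤ) ≤ g v u → Real.log (1 + R / t) ≤ dist (x u) (x v) := by
    intro u v huv
    rw [IntSeq.dist_eq]
    apply Real.log_le_log (by positivity)
    have h1 := IntSeq.abs_sub_le_norm_ofFin_sub (fun k => ⌈(g k u : ℝ) / (t : ℤ)⌉)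
      (fun k => ⌈(g k v : ℝ) / (t : ℤ)⌉) v
    simp only [hg0] at h1
    have h3 : (R : ℝ) / t ≤ ⌈(g v u : ℝ) / (t : ℤ)⌉ := by
      refine le_trans ?_ (Int.le_ceil _)
      have : (R : ℝ) ≤ g v u := by exact_mod_cast huv
      push_cast
      gcongr
    have h4 : (⌈(g v u : ℝ) / (t : ℤ)⌉ : ℝ) ≤
        |(⌈(g v u : ℝ) / (t : ℤ)⌉ : ℝ) - (⌈((0 : ℤ) : ℝ) / (t : ℤ)⌉ : ℤ)| := by
      simpa using le_abs_self _
    linarith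
  have hl : 0 ≤ Real.log (1 + R / t) := Real.log_nonneg (by
    have : (0 : ℝ) ≤ R / t := by positivity
    linarith)
  simp only [sqDist, NNReal.coe_pow, coe_nndist, Fintype.card_fin] at h
  have hright : ∑ i, ∑ j, G.normAdj i j * dist (x i) (x j) ^ 2 ≤ n * Real.log 2 ^ 2 := by
    have hs := G.isSymmStochastic_normAdj
    calc ∑ i, ∑ j, G.normAdj i j * dist (x i) (x j) ^ 2
        ≤ ∑ i, ∑ j, G.normAdj i j * Real.log 2 ^ 2 := by
          refine Finset.sum_le_sum fun i _ => Finset.sum_le_sum fun j _ => ?_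
          by_cases hij : G.mult i j = 0
          · simp [RegularMultigraph.normAdj, hij]
          · exact mul_le_mul_of_nonneg_left (pow_le_pow_left₀ dist_nonneg (hedge i j hij) 2)
              (hs.2.1 i j)
      _ = _ := by simp [← Finset.sum_mul, hs.2.2]
  have hleft : (n : ℝ) ^ 2 / 2 * Real.log (1 + R / t) ^ 2 ≤
      ∑ i, ∑ j, dist (x i) (x j) ^ 2 := by
    rw [← Finset.sum_product', Finset.univ_product_univ]
    calc (n : ℝ) ^ 2 / 2 * Real.log (1 + R / t) ^ 2
        ≤ (Finset.univ.filter fun p : Fin n × Fin n => (R : ℤ) ≤ g p.2 p.1).card *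
            Real.log (1 + R / t) ^ 2 := by
          gcongr
          rw [div_le_iff₀ two_pos, mul_comm]
          exact_mod_cast hR
      _ = ∑ p ∈ Finset.univ.filter fun p : Fin n × Fin n => (R : ℤ) ≤ g p.2 p.1,
            Real.log (1 + R / t) ^ 2 := by simp
      _ ≤ ∑ p ∈ Finset.univ.filter fun p : Fin n × Fin n => (R : ℤ) ≤ g p.2 p.1,
            dist (x p.1) (x p.2) ^ 2 := by
          refine Finset.sum_le_sum fun p hp => ?_
          exact pow_le_pow_left₀ hl (hfar _ _ (Finset.mem_filter.mp hp).2) 2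
      _ ≤ _ := Finset.sum_le_sum_of_subset_of_nonneg (Finset.subset_univ _)
          fun _ _ _ => sq_nonneg _
  have h5 : (1 / (n : ℝ) ^ 2) * ((n : ℝ) ^ 2 / 2 * Real.log (1 + R / t) ^ 2) ≤
      c / n * (n * Real.log 2 ^ 2) :=
    (mul_le_mul_of_nonneg_left hleft (by positivity)).trans
      (h.trans (mul_le_mul_of_nonneg_left hright (by positivity)))
  rw [div_pow, div_div, div_le_iff₀ (by positivity)]
  have h6 : (1 / (n : ℝ) ^ 2) * ((n : ℝ) ^ 2 / 2 * Real.log (1 + R / t) ^ 2) =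
      Real.log (1 + R / t) ^ 2 / 2 := by field_simp
  have h7 : c / n * (n * Real.log 2 ^ 2) = c * Real.log 2 ^ 2 := by field_simp
  rw [h6, h7] at h5
  linarith

/-- The graph with one edge between any two vertices. -/
def RegularMultigraph.complete (V : Type*) [Fintype V] [Nonempty V] : RegularMultigraph V where
  mult _ _ := 1
  symm _ _ := rfl
  degree := Fintype.card V
  degree_pos := Fintype.card_pos
  sum_mult _ := by simp

theorem RegularMultigraph.gammaPlus_complete_lt_top (V : Type*) [Fintype V] [DecidableEq V]
    [Nonempty V] {X : Type*} (K : X → X → ℝ≥0) : (complete V).gammaPlus K < ⊤ := by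
  refine lt_of_le_of_lt (iInf₂_le (1 : ℝ) ⟨one_pos, fun x y => ?_⟩) ENNReal.ofReal_lt_top
  simp only [normAdj, complete, Matrix.of_apply, Nat.cast_one, ← Finset.mul_sum]
  rw [← mul_assoc, ← sq, one_div_pow]

/-! ### Fourier analysis on finite abelian groups -/

section Characters

variable {V : Type*} [AddCommGroup V] [Fintype V] [DecidableEq V]

theorem sum_normSq_fourier (g : V → ℝ) :
    ∑ χ : AddChar V ℂ, Complex.normSq (∑ x, (g x : ℂ) * χ x) =
      Fintype.card V * ∑ x, g x ^ 2 := by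
  have h : (∑ χ : AddChar V ℂ, (Complex.normSq (∑ x, (g x : ℂ) * χ x) : ℂ)) =
      Fintype.card V * ∑ x, (g x : ℂ) ^ 2 := by
    calc (∑ χ : AddChar V ℂ, (Complex.normSq (∑ x, (g x : ℂ) * χ x) : ℂ))
        = ∑ χ : AddChar V ℂ, ∑ x, ∑ y, (g x : ℂ) * g y * χ (x - y) := by
          refine Finset.sum_congr rfl fun χ _ => ?_
          rw [← Complex.mul_conj, map_sum, Finset.sum_mul_sum]
          refine Finset.sum_congr rfl fun x _ => Finset.sum_congr rfl fun y _ => ?_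
          rw [map_mul, Complex.conj_ofReal, ← AddChar.map_neg_eq_conj, sub_eq_add_neg,
            AddChar.map_add_eq_mul]
          ring
      _ = ∑ x, ∑ y, (g x : ℂ) * g y * ∑ χ : AddChar V ℂ, χ (x - y) := by
          rw [Finset.sum_comm]
          refine Finset.sum_congr rfl fun x _ => ?_
          rw [Finset.sum_comm]
          exact Finset.sum_congr rfl fun y _ => by rw [Finset.mul_sum]
      _ = _ := by
          rw [Finset.mul_sum]
          refine Finset.sum_congr rfl fun x _ => ?_
          simp only [AddChar.sum_apply_eq_ite, sub_eq_zero, mul_ite, mul_zero]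
          rw [Finset.sum_ite_eq Finset.univ x, if_pos (Finset.mem_univ _)]
          ring
  exact_mod_cast h

/-- Translation by `w` multiplies the coefficient at `χ` by `χ (-w)`, and `|χ (-w) - 1| ^ 2 = 2 - 2
Re χ(w)`; Plancherel concludes. -/
theorem card_mul_sum_sq_translate_sub (f : V → ℝ) (w : V) :
    Fintype.card V * ∑ x, (f (x + w) - f x) ^ 2 =
      ∑ χ : AddChar V ℂ, Complex.normSq (∑ x, (f x : ℂ) * χ x) * (2 - 2 * (χ w).re) := by
  rw [← sum_normSq_fourier fun x => f (x + w) - f x]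
  refine Finset.sum_congr rfl fun χ _ => ?_
  have h1 : ∑ x, ((f (x + w) - f x : ℝ) : ℂ) * χ x =
      (∑ x, (f x : ℂ) * χ x) * (χ (-w) - 1) := by
    push_cast
    simp only [sub_mul, Finset.sum_sub_distrib, mul_sub, mul_one]
    congr 1
    rw [← Equiv.sum_comp (Equiv.subRight w), Finset.sum_mul]
    refine Finset.sum_congr rfl fun x _ => ?_
    simp only [Equiv.subRight_apply, sub_add_cancel]
    rw [sub_eq_add_neg, AddChar.map_add_eq_mul]
    ring
  rw [h1, Complex.normSq_mul]
  congr 1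
  have h2 : Complex.normSq (χ (-w)) = 1 := by
    rw [Complex.normSq_eq_norm_sq, AddChar.norm_apply, one_pow]
  rw [Complex.normSq_sub, h2, AddChar.map_neg_eq_conj]
  simp
  ring

/-- The Poincaré inequality on a finite abelian group for the steps `s i`, given a bound on the
nontrivial eigenvalues of the walk with these steps. -/
theorem card_mul_sum_sq_sub_le_of_re_sum_le {ι : Type*} [Fintype ι] (s : ι → V)
    (h : ∀ χ : AddChar V ℂ, χ ≠ 0 → 2 * (∑ i, χ (s i)).re ≤ Fintype.card ι) (f : V → ℝ) :
    Fintype.card ι * ∑ x, ∑ y, (f x - f y) ^ 2 ≤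
      2 * Fintype.card V * ∑ x, ∑ i, (f x - f (x + s i)) ^ 2 := by
  classical
  have hN : (0 : ℝ) < Fintype.card V := by exact_mod_cast Fintype.card_pos
  set F : AddChar V ℂ → ℝ := fun χ => Complex.normSq (∑ x, (f x : ℂ) * χ x) with hF
  have h1 : ∑ x, ∑ y, (f x - f y) ^ 2 = ∑ w, ∑ x, (f (x + w) - f x) ^ 2 := by
    rw [Finset.sum_comm (s := Finset.univ) (t := Finset.univ)
      (f := fun w x => (f (x + w) - f x) ^ 2)]
    refine Finset.sum_congr rfl fun x _ => ?_
    rw [← Equiv.sum_comp (Equiv.addLeft x)]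
    refine Finset.sum_congr rfl fun w _ => ?_
    rw [Equiv.coe_addLeft]
    ring
  have h2 : ∑ x, ∑ i, (f x - f (x + s i)) ^ 2 = ∑ i, ∑ x, (f (x + s i) - f x) ^ 2 := by
    rw [Finset.sum_comm]
    exact Finset.sum_congr rfl fun i _ => Finset.sum_congr rfl fun x _ => by ring
  have h3 : Fintype.card V * ∑ w, ∑ x, (f (x + w) - f x) ^ 2 =
      ∑ χ : AddChar V ℂ, F χ * (2 * Fintype.card V - 2 * (∑ w, χ w).re) := by
    simp only [Finset.mul_sum (s := Finset.univ) (a := (Fintype.card V : ℝ))]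
    simp only [← Finset.mul_sum, card_mul_sum_sq_translate_sub]
    rw [Finset.sum_comm]
    refine Finset.sum_congr rfl fun χ _ => ?_
    rw [← Finset.mul_sum, Finset.sum_sub_distrib, ← Finset.mul_sum, Complex.re_sum]
    simp [mul_comm, hF]
  have h4 : Fintype.card V * ∑ i, ∑ x, (f (x + s i) - f x) ^ 2 =
      ∑ χ : AddChar V ℂ, F χ * (2 * Fintype.card ι - 2 * (∑ i, χ (s i)).re) := by
    simp only [Finset.mul_sum (s := Finset.univ) (a := (Fintype.card V : ℝ))]
    simp only [← Finset.mul_sum, card_mul_sum_sq_translate_sub]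
    rw [Finset.sum_comm]
    refine Finset.sum_congr rfl fun χ _ => ?_
    rw [← Finset.mul_sum, Finset.sum_sub_distrib, ← Finset.mul_sum, Complex.re_sum]
    simp [mul_comm, hF]
  rw [h1, h2]
  have h5 : (Fintype.card V : ℝ) *
      (Fintype.card ι * ∑ w, ∑ x, (f (x + w) - f x) ^ 2) ≤ Fintype.card V *
      (2 * Fintype.card V * ∑ i, ∑ x, (f (x + s i) - f x) ^ 2) := by
    rw [mul_left_comm, h3, mul_left_comm, h4, Finset.mul_sum, Finset.mul_sum]
    refine Finset.sum_le_sum fun χ _ => ?_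
    have hF0 : 0 ≤ F χ := Complex.normSq_nonneg _
    rw [mul_left_comm, mul_left_comm _ (F χ)]
    refine mul_le_mul_of_nonneg_left ?_ hF0
    -- The trivial character contributes `0` to both sides; for the others the eigenvalue bound `1 /
    -- 2` applies.
    by_cases hχ : χ = 0
    · subst hχ
      simp
    · rw [AddChar.sum_eq_zero_iff_ne_zero.mpr hχ, Complex.zero_re]
      nlinarith [h χ hχ]
  exact le_of_mul_le_mul_left h5 hN

end Characters

/-! ### The spectral gap of the moment curve -/

section MomentCurve

variable {F : Type*} [Field F] [Fintype F] (l : ℕ)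

/-- The multiples of the points of the moment curve in `F ^ l`. -/
def momentStep (p : F × F) : Fin l → F := fun k => p.2 * p.1 ^ (k : ℕ)

/-- Any `l` distinct points of the moment curve form a basis, by Vandermonde, so a character trivial
on `l` of the lines is trivial. -/
theorem card_le_of_addChar_trivial_on_lines (χ : AddChar (Fin l → F) ℂ) (hχ : χ ≠ 0) :
    (Finset.univ.filter fun a : F => ∀ b : F, χ (momentStep l (a, b)) = 1).card < l := by
  by_contra hcard
  push Not at hcard
  obtain ⟨S, hS, hSl⟩ := Finset.exists_subset_card_eq hcard
  let v : Fin l → F := fun i => (S.equivFinOfCardEq hSl).symm i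
  have hv : Function.Injective v := Subtype.val_injective.comp (Equiv.injective _)
  have hv1 : ∀ i b, χ (momentStep l (v i, b)) = 1 := fun i =>
    (Finset.mem_filter.mp (hS ((S.equivFinOfCardEq hSl).symm i).2)).2
  have hdet : IsUnit (Matrix.vandermonde v).det :=
    isUnit_iff_ne_zero.mpr (Matrix.det_vandermonde_ne_zero_iff.mpr hv)
  apply hχ
  ext y
  have hy : y = ∑ i, momentStep l (v i, (Matrix.vecMul y (Matrix.vandermonde v)⁻¹) i) := by
    have h1 : Matrix.vecMul (Matrix.vecMul y (Matrix.vandermonde v)⁻¹) (Matrix.vandermonde v) =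
        y := by
      rw [Matrix.vecMul_vecMul, Matrix.nonsing_inv_mul _ hdet, Matrix.vecMul_one]
    conv_lhs => rw [← h1]
    ext k
    simp [Matrix.vecMul, dotProduct, momentStep, Matrix.vandermonde_apply, Finset.sum_apply]
  have hsum : ∀ (c : Fin l → F) (s : Finset (Fin l)),
      χ (∑ i ∈ s, momentStep l (v i, c i)) = 1 := by
    intro c s
    induction s using Finset.induction_on with
    | empty => simp
    | insert i s hi ih => rw [Finset.sum_insert hi, AddChar.map_add_eq_mul, ih, hv1, mul_one]
  rw [hy, hsum, AddChar.zero_apply]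

variable [DecidableEq F]

/-- The sum over a line is `|F|` if `χ` is trivial on it and `0` otherwise, and at most `l - 1 ≤ |F|
/ 2` lines are of the first kind. -/
theorem two_mul_re_sum_momentStep_le (hl : 2 * l ≤ Fintype.card F + 2)
    (χ : AddChar (Fin l → F) ℂ) (hχ : χ ≠ 0) :
    2 * (∑ p : F × F, χ (momentStep l p)).re ≤ Fintype.card (F × F) := by
  have hcard := card_le_of_addChar_trivial_on_lines l χ hχ
  set S := Finset.univ.filter fun a : F => ∀ b : F, χ (momentStep l (a, b)) = 1 with hS
  have h1 : ∀ a : F, ∑ b, χ (momentStep l (a, b)) = if a ∈ S then (Fintype.card F : ℂ) else 0 := by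
    intro a
    let L : F →+ (Fin l → F) :=
      { toFun := fun b => momentStep l (a, b)
        map_zero' := by ext; simp [momentStep]
        map_add' := fun b c => by ext; simp [momentStep, add_mul] }
    have h2 := AddChar.sum_eq_ite (χ.compAddMonoidHom L)
    have h3 : χ.compAddMonoidHom L = 0 ↔ a ∈ S := by
      simp only [hS, Finset.mem_filter, Finset.mem_univ, true_and]
      exact ⟨fun h b => DFunLike.congr_fun h b, fun h => by
        ext b
        exact h b⟩
    simp only [h3] at h2
    exact h2
  rw [Fintype.sum_prod_type]
  simp only [h1]
  rw [Finset.sum_ite_mem, Finset.univ_inter, Finset.sum_const, nsmul_eq_mul]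
  have h4 : 2 * (S.card * Fintype.card F) ≤ Fintype.card F * Fintype.card F := by
    rw [← mul_assoc]
    exact Nat.mul_le_mul_right _ (by omega)
  rw [Fintype.card_prod]
  have h5 : ((S.card : ℂ) * (Fintype.card F : ℂ)).re = S.card * Fintype.card F := by
    rw [← Nat.cast_mul, Complex.natCast_re]
    push_cast
    ring
  rw [h5]
  exact_mod_cast h4

theorem momentStep_poincare (hl : 2 * l ≤ Fintype.card F + 2) (f : (Fin l → F) → ℝ) :
    Fintype.card (F × F) * ∑ x, ∑ y, (f x - f y) ^ 2 ≤
      2 * Fintype.card (Fin l → F) * ∑ x, ∑ p : F × F, (f x - f (x + momentStep l p)) ^ 2 :=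
  card_mul_sum_sq_sub_le_of_re_sum_le _ (two_mul_re_sum_momentStep_le l hl) f

end MomentCurve

/-- The decomposition of the energy between two sets into the differences of the means and the
variances. -/
theorem sum_sum_sq_sub_eq {W : Type*} (f : W → ℝ) (P Q : Finset W)
    (hP : P.Nonempty) (hQ : Q.Nonempty) :
    ∑ i ∈ P, ∑ j ∈ Q, (f i - f j) ^ 2 = P.card * Q.card *
      (((∑ i ∈ P, f i) / P.card - (∑ i ∈ Q, f i) / Q.card) ^ 2 +
        (∑ i ∈ P, (f i - (∑ i ∈ P, f i) / P.card) ^ 2) / P.card +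
        (∑ i ∈ Q, (f i - (∑ i ∈ Q, f i) / Q.card) ^ 2) / Q.card) := by
  have hp : (P.card : ℝ) ≠ 0 := by exact_mod_cast hP.card_pos.ne'
  have hq : (Q.card : ℝ) ≠ 0 := by exact_mod_cast hQ.card_pos.ne'
  simp only [sub_sq, Finset.sum_add_distrib, Finset.sum_sub_distrib, Finset.sum_const,
    nsmul_eq_mul, ← Finset.mul_sum, ← Finset.sum_mul]
  field_simp
  ring

/-! ### Blow-ups to an arbitrary number of vertices -/

section BlowUp

variable {V W : Type*} [Fintype V] [DecidableEq V] [Fintype W]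

theorem RegularMultigraph.sum_mult_comp_le (H : RegularMultigraph V) (π : W → V) (c : ℕ)
    (hπ : ∀ v, (Finset.univ.filter fun i => π i = v).card ≤ c) (u : V) :
    ∑ k, H.mult u (π k) ≤ c * H.degree := by
  rw [← Finset.sum_fiberwise Finset.univ π, ← H.sum_mult u, Finset.mul_sum]
  refine Finset.sum_le_sum fun v _ => ?_
  rw [Finset.sum_congr rfl fun k hk => by rw [(Finset.mem_filter.mp hk).2], Finset.sum_const,
    smul_eq_mul]
  exact Nat.mul_le_mul_right _ (hπ v)

variable [DecidableEq W]

/-- The blow-up of a regular graph along a map with fibres of at most `2 * s` points, made regular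
by adding self loops, which are at least half of the edges at each vertex. -/
def RegularMultigraph.blowUp (H : RegularMultigraph V) (π : W → V) (s : ℕ) (hs : 0 < s)
    (hπ : ∀ v, (Finset.univ.filter fun i => π i = v).card ≤ 2 * s) : RegularMultigraph W where
  mult i j := H.mult (π i) (π j) +
    if i = j then 4 * s * H.degree - ∑ k, H.mult (π i) (π k) else 0
  symm i j := by
    rw [H.symm]
    by_cases h : i = j
    · subst h; rfl
    · simp [h, Ne.symm h]
  degree := 4 * s * H.degree
  degree_pos := by have := H.degree_pos; positivity
  sum_mult i := by
    have := H.sum_mult_comp_le π (2 * s) hπ (π i)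
    rw [Finset.sum_add_distrib, Finset.sum_ite_eq Finset.univ i, if_pos (Finset.mem_univ i)]
    have : 2 * s * H.degree ≤ 4 * s * H.degree := Nat.mul_le_mul_right _ (by omega)
    omega

theorem RegularMultigraph.half_le_normAdj_blowUp (H : RegularMultigraph V) (π : W → V) (s : ℕ)
    (hs : 0 < s) (hπ : ∀ v, (Finset.univ.filter fun i => π i = v).card ≤ 2 * s) (i : W) :
    1 / 2 ≤ (H.blowUp π s hs hπ).normAdj i i := by
  have h := H.sum_mult_comp_le π (2 * s) hπ (π i)
  have hd : (0 : ℝ) < (H.blowUp π s hs hπ).degree := by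
    exact_mod_cast (H.blowUp π s hs hπ).degree_pos
  simp only [normAdj, Matrix.of_apply]
  rw [div_le_div_iff₀ two_pos hd, one_mul]
  have : (H.blowUp π s hs hπ).degree ≤ (H.blowUp π s hs hπ).mult i i * 2 := by
    simp only [blowUp, if_true]
    have : 4 * s * H.degree = 2 * (2 * s * H.degree) := by ring
    omega
  exact_mod_cast this

theorem RegularMultigraph.of_blowUp_mult_ne_zero (H : RegularMultigraph V) (π : W → V) (s : ℕ)
    (hs : 0 < s) (hπ : ∀ v, (Finset.univ.filter fun i => π i = v).card ≤ 2 * s) (i j : W)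
    (h : (H.blowUp π s hs hπ).mult i j ≠ 0) : i = j ∨ H.mult (π i) (π j) ≠ 0 := by
  by_cases hij : i = j
  · exact Or.inl hij
  · right
    simpa [blowUp, hij] using h

/-- The energy splits into that of the fibre means, handled by the gap of `H`, and the variances in
the fibres, handled by regularity. One factor `4` comes from fibre sizes between `s` and `2 * s`,
the other from the degree `4 * s * H.degree`. -/
theorem HasRealGap.blowUp [Nonempty V] {H : RegularMultigraph V} {κ : ℝ} (hκ : 1 ≤ κ)
    (hgap : HasRealGap H.normAdj κ) (π : W → V) (s : ℕ) (hs : 0 < s)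
    (hπ : ∀ v, (Finset.univ.filter fun i => π i = v).card ≤ 2 * s)
    (hπ' : ∀ v, s ≤ (Finset.univ.filter fun i => π i = v).card) :
    HasRealGap (H.blowUp π s hs hπ).normAdj (16 * κ) := by
  intro f
  have hd : (0 : ℝ) < H.degree := by exact_mod_cast H.degree_pos
  have hN : (0 : ℝ) < Fintype.card V := by exact_mod_cast Fintype.card_pos
  have hs' : (0 : ℝ) < s := by exact_mod_cast hs
  let P : V → Finset W := fun v => Finset.univ.filter fun i => π i = v
  have hPne : ∀ v, (P v).Nonempty := fun v => Finset.card_pos.mp (lt_of_lt_of_le hs (hπ' v))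
  let m : V → ℝ := fun v => (∑ i ∈ P v, f i) / (P v).card
  let vr : V → ℝ := fun v => (∑ i ∈ P v, (f i - m v) ^ 2) / (P v).card
  have hvr : ∀ v, 0 ≤ vr v := fun v =>
    div_nonneg (Finset.sum_nonneg fun _ _ => sq_nonneg _) (Nat.cast_nonneg _)
  let Φ : V → V → ℝ := fun u v => (m u - m v) ^ 2 + vr u + vr v
  have hΦ : ∀ u v, 0 ≤ Φ u v := fun u v =>
    add_nonneg (add_nonneg (sq_nonneg _) (hvr u)) (hvr v)
  have hfib : ∀ c : V → V → ℝ, ∑ i, ∑ j, c (π i) (π j) * (f i - f j) ^ 2 =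
      ∑ u, ∑ v, c u v * ((P u).card * (P v).card * Φ u v) := by
    intro c
    rw [← Finset.sum_fiberwise Finset.univ π]
    refine Finset.sum_congr rfl fun u _ => ?_
    calc ∑ i ∈ P u, ∑ j, c (π i) (π j) * (f i - f j) ^ 2
        = ∑ i ∈ P u, ∑ v, ∑ j ∈ P v, c u v * (f i - f j) ^ 2 := by
          refine Finset.sum_congr rfl fun i hi => ?_
          rw [← Finset.sum_fiberwise Finset.univ π, (Finset.mem_filter.mp hi).2]
          refine Finset.sum_congr rfl fun v _ => Finset.sum_congr rfl fun j hj => ?_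
          rw [(Finset.mem_filter.mp hj).2]
      _ = ∑ v, ∑ i ∈ P u, ∑ j ∈ P v, c u v * (f i - f j) ^ 2 := Finset.sum_comm
      _ = _ := by
          refine Finset.sum_congr rfl fun v _ => ?_
          simp only [← Finset.mul_sum]
          rw [sum_sum_sq_sub_eq f (P u) (P v) (hPne u) (hPne v)]
  have h1 : ∑ i, ∑ j, (f i - f j) ^ 2 ≤ 4 * s ^ 2 * ∑ u, ∑ v, Φ u v := by
    have := hfib fun _ _ => 1
    simp only [one_mul] at this
    rw [this, Finset.mul_sum]
    refine Finset.sum_le_sum fun u _ => ?_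
    rw [Finset.mul_sum]
    refine Finset.sum_le_sum fun v _ => mul_le_mul_of_nonneg_right ?_ (hΦ u v)
    have hu : ((P u).card : ℝ) ≤ 2 * s := by exact_mod_cast hπ u
    have hv : ((P v).card : ℝ) ≤ 2 * s := by exact_mod_cast hπ v
    calc ((P u).card : ℝ) * (P v).card ≤ (2 * s) * (2 * s) := by gcongr
      _ = _ := by ring
  set E := ∑ i, ∑ j, (H.mult (π i) (π j) : ℝ) * (f i - f j) ^ 2 with hE
  have h2 : (s : ℝ) ^ 2 * ∑ u, ∑ v, (H.mult u v : ℝ) * Φ u v ≤ E := by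
    rw [hE, hfib fun u v => (H.mult u v : ℝ), Finset.mul_sum]
    refine Finset.sum_le_sum fun u _ => ?_
    rw [Finset.mul_sum]
    refine Finset.sum_le_sum fun v _ => ?_
    rw [mul_left_comm]
    refine mul_le_mul_of_nonneg_left (mul_le_mul_of_nonneg_right ?_ (hΦ u v)) (Nat.cast_nonneg _)
    have hu : (s : ℝ) ≤ (P u).card := by exact_mod_cast hπ' u
    have hv : (s : ℝ) ≤ (P v).card := by exact_mod_cast hπ' v
    rw [sq]
    gcongr
  have h3 : H.degree * ∑ u, ∑ v, Φ u v ≤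
      κ * Fintype.card V * ∑ u, ∑ v, (H.mult u v : ℝ) * Φ u v := by
    have hm := hgap m
    have hsplit : ∑ u, ∑ v, H.normAdj u v * (m u - m v) ^ 2 =
        (∑ u, ∑ v, (H.mult u v : ℝ) * (m u - m v) ^ 2) / H.degree := by
      simp only [RegularMultigraph.normAdj, Matrix.of_apply, Finset.sum_div]
      refine Finset.sum_congr rfl fun u _ => Finset.sum_congr rfl fun v _ => ?_
      ring
    rw [hsplit, mul_div_assoc', le_div_iff₀ hd] at hm
    have hrow : ∀ u, ∑ v, (H.mult u v : ℝ) = H.degree := fun u => by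
      exact_mod_cast H.sum_mult u
    have hcol : ∀ v, ∑ u, (H.mult u v : ℝ) = H.degree := fun v => by
      rw [← hrow v]
      exact Finset.sum_congr rfl fun u _ => by rw [H.symm]
    have hA : ∑ u, ∑ v, Φ u v =
        ∑ u, ∑ v, (m u - m v) ^ 2 + 2 * Fintype.card V * ∑ u, vr u := by
      simp only [Φ, Finset.sum_add_distrib, Finset.sum_const, Finset.card_univ, nsmul_eq_mul,
        ← Finset.mul_sum]
      ring
    have hB : ∑ u, ∑ v, (H.mult u v : ℝ) * Φ u v =
        ∑ u, ∑ v, (H.mult u v : ℝ) * (m u - m v) ^ 2 + 2 * H.degree * ∑ u, vr u := by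
      simp only [Φ, mul_add, Finset.sum_add_distrib]
      have e1 : ∑ u, ∑ v, (H.mult u v : ℝ) * vr u = H.degree * ∑ u, vr u := by
        simp only [← Finset.sum_mul, hrow, Finset.mul_sum]
      have e2 : ∑ u, ∑ v, (H.mult u v : ℝ) * vr v = H.degree * ∑ u, vr u := by
        rw [Finset.sum_comm]
        simp only [← Finset.sum_mul, hcol, Finset.mul_sum]
      rw [e1, e2]
      ring
    have hv : 0 ≤ ∑ u, vr u := Finset.sum_nonneg fun u _ => hvr u
    rw [hA, hB]
    have h4 : (Fintype.card V : ℝ) * (H.degree * ∑ u, vr u) ≤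
        κ * (Fintype.card V * (H.degree * ∑ u, vr u)) :=
      le_mul_of_one_le_left (by positivity) hκ
    nlinarith
  have hn : (s : ℝ) * Fintype.card V ≤ Fintype.card W := by
    have : ∑ v : V, s ≤ ∑ v, (P v).card := Finset.sum_le_sum fun v _ => hπ' v
    rw [Finset.sum_const, Finset.card_univ, smul_eq_mul,
      ← Finset.card_eq_sum_card_fiberwise (fun _ _ => Finset.mem_coe.mpr (Finset.mem_univ _)),
      Finset.card_univ, mul_comm] at this
    exact_mod_cast this
  have h5 : E / (4 * s * H.degree) ≤
      ∑ i, ∑ j, (H.blowUp π s hs hπ).normAdj i j * (f i - f j) ^ 2 := by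
    rw [hE, Finset.sum_div]
    refine Finset.sum_le_sum fun i _ => ?_
    rw [Finset.sum_div]
    refine Finset.sum_le_sum fun j _ => ?_
    rw [mul_div_right_comm]
    refine mul_le_mul_of_nonneg_right ?_ (sq_nonneg _)
    simp only [RegularMultigraph.normAdj, RegularMultigraph.blowUp, Matrix.of_apply]
    push_cast
    gcongr
    exact le_add_of_nonneg_right (by positivity)
  have hE0 : 0 ≤ E := Finset.sum_nonneg fun i _ => Finset.sum_nonneg fun j _ =>
    mul_nonneg (Nat.cast_nonneg _) (sq_nonneg _)
  calc ∑ i, ∑ j, (f i - f j) ^ 2 ≤ 4 * s ^ 2 * ∑ u, ∑ v, Φ u v := h1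
    _ = 4 * s ^ 2 / H.degree * (H.degree * ∑ u, ∑ v, Φ u v) := by field_simp
    _ ≤ 4 * s ^ 2 / H.degree * (κ * Fintype.card V * ∑ u, ∑ v, (H.mult u v : ℝ) * Φ u v) := by
        gcongr
    _ = 4 * κ * Fintype.card V / H.degree * (s ^ 2 * ∑ u, ∑ v, (H.mult u v : ℝ) * Φ u v) := by
        ring
    _ ≤ 4 * κ * Fintype.card V / H.degree * E := by gcongr
    _ = 16 * κ * (s * Fintype.card V) * (E / (4 * s * H.degree)) := by field_simp; ring
    _ ≤ 16 * κ * Fintype.card W * (E / (4 * s * H.degree)) := by gcongr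
    _ ≤ _ := by gcongr

end BlowUp

/-- Maps from `Fin n` with almost equal fibres. -/
theorem exists_map_card_fiber (V : Type*) [Fintype V] [DecidableEq V] [Nonempty V] (n : ℕ)
    (hn : Fintype.card V ≤ n) : ∃ π : Fin n → V, ∀ v,
      n / Fintype.card V ≤ (Finset.univ.filter fun i => π i = v).card ∧
      (Finset.univ.filter fun i => π i = v).card ≤ 2 * (n / Fintype.card V) := by
  have hN : 0 < Fintype.card V := Fintype.card_pos
  have hs : 1 ≤ n / Fintype.card V := (Nat.one_le_div_iff hN).mpr hn
  let e := Fintype.equivFin V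
  refine ⟨fun i => e.symm ⟨i % Fintype.card V, Nat.mod_lt _ hN⟩, fun v => ?_⟩
  have h : (Finset.univ.filter fun i : Fin n =>
      e.symm ⟨i % Fintype.card V, Nat.mod_lt _ hN⟩ = v).card =
      n.count (· ≡ (e v : ℕ) [MOD Fintype.card V]) := by
    rw [Nat.count_eq_card_filter_range, ← Finset.card_map Fin.valEmbedding]
    congr 1
    ext k
    simp only [Finset.mem_map, Finset.mem_filter, Finset.mem_univ, true_and,
      Fin.valEmbedding_apply, Finset.mem_range, Nat.ModEq, Equiv.symm_apply_eq, Fin.ext_iff,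
      Nat.mod_eq_of_lt (e v).isLt]
    constructor
    · rintro ⟨i, hi, rfl⟩
      exact ⟨i.isLt, hi⟩
    · rintro ⟨hk, hk'⟩
      exact ⟨⟨k, hk⟩, hk', rfl⟩
  rw [h, Nat.count_modEq_card _ hN]
  split_ifs <;> omega

/-! ### Distances in the moment graph -/

section MomentGraph

variable {F : Type*} [Field F] (l : ℕ)

theorem momentStep_neg (a b : F) : momentStep l (a, -b) = -momentStep l (a, b) := by
  ext
  simp [momentStep]

theorem momentStep_zero (a : F) : momentStep l (a, 0) = 0 := by
  ext
  simp [momentStep]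

variable [Fintype F] [DecidableEq F]

variable (F) in
/-- The Cayley graph of `F ^ l` for the multiples of the points of the moment curve. -/
def momentGraph : RegularMultigraph (Fin l → F) where
  mult u v := (Finset.univ.filter fun p : F × F => u + momentStep l p = v).card
  symm u v := by
    refine Finset.card_equiv ((Equiv.refl F).prodCongr (Equiv.neg F)) fun p => ?_
    obtain ⟨a, b⟩ := p
    simp only [Finset.mem_filter, Finset.mem_univ, true_and, Equiv.prodCongr_apply, Prod.map,
      Equiv.refl_apply, Equiv.neg_apply, momentStep_neg, ← sub_eq_add_neg, sub_eq_iff_eq_add]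
    exact eq_comm
  degree := Fintype.card (F × F)
  degree_pos := Fintype.card_pos
  sum_mult u := by
    rw [← Finset.card_eq_sum_card_fiberwise (fun _ _ => Finset.mem_coe.mpr (Finset.mem_univ _)),
      Finset.card_univ]

theorem hasRealGap_momentGraph (hl : 2 * l ≤ Fintype.card F + 2) :
    HasRealGap (momentGraph F l).normAdj 2 := by
  intro f
  have hd : (0 : ℝ) < Fintype.card (F × F) := by exact_mod_cast Fintype.card_pos
  have h := momentStep_poincare l hl f
  have h1 : ∑ x, ∑ y, (momentGraph F l).normAdj x y * (f x - f y) ^ 2 =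
      (∑ x, ∑ p : F × F, (f x - f (x + momentStep l p)) ^ 2) / Fintype.card (F × F) := by
    rw [Finset.sum_div]
    refine Finset.sum_congr rfl fun x _ => ?_
    rw [← Finset.sum_fiberwise Finset.univ (fun p => x + momentStep l p), Finset.sum_div]
    refine Finset.sum_congr rfl fun y _ => ?_
    rw [Finset.sum_congr rfl fun p hp => by rw [(Finset.mem_filter.mp hp).2], Finset.sum_const,
      nsmul_eq_mul]
    simp only [RegularMultigraph.normAdj, momentGraph, Matrix.of_apply]
    ring
  rw [h1, mul_div_assoc', le_div_iff₀ hd]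
  linarith

theorem exists_of_momentGraph_mult_ne_zero {u v : Fin l → F}
    (h : (momentGraph F l).mult u v ≠ 0) : ∃ p, u + momentStep l p = v := by
  obtain ⟨p, hp⟩ := Finset.card_pos.mp (Nat.pos_of_ne_zero h)
  exact ⟨p, (Finset.mem_filter.mp hp).2⟩

variable (F) in
/-- The sums of `r` steps. -/
def stepBall : ℕ → Finset (Fin l → F)
  | 0 => {0}
  | r + 1 => (stepBall r ×ˢ Finset.univ).image fun x : (Fin l → F) × F × F =>
      x.1 + momentStep l x.2

theorem card_stepBall_le (r : ℕ) : (stepBall F l r).card ≤ Fintype.card F ^ (2 * r) := by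
  induction r with
  | zero => simp [stepBall]
  | succ r ih =>
    refine Finset.card_image_le.trans ?_
    rw [Finset.card_product, Finset.card_univ, Fintype.card_prod]
    calc _ ≤ Fintype.card F ^ (2 * r) * (Fintype.card F * Fintype.card F) :=
          Nat.mul_le_mul_right _ ih
      _ = _ := by ring

theorem add_momentStep_mem_stepBall {r : ℕ} {u : Fin l → F} (hu : u ∈ stepBall F l r)
    (p : F × F) : u + momentStep l p ∈ stepBall F l (r + 1) :=
  Finset.mem_image.mpr ⟨(u, p), by simpa using hu, rfl⟩

/-- Zero is itself a step. -/
theorem stepBall_mono : Monotone (stepBall F l) :=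
  monotone_nat_of_le_succ fun r u hu => by
    simpa [momentStep_zero] using add_momentStep_mem_stepBall l hu (0, 0)

/-- The word length with respect to the steps, truncated at `R`. -/
def stepLength (R : ℕ) (u : Fin l → F) : ℕ :=
  ((Finset.range R).filter fun r => u ∉ stepBall F l r).card

theorem stepLength_zero (R : ℕ) : stepLength l R (0 : Fin l → F) = 0 := by
  rw [stepLength, Finset.card_eq_zero, Finset.filter_eq_empty_iff]
  intro r _ h
  exact h (stepBall_mono l (Nat.zero_le r) (by simp [stepBall]))

theorem stepLength_add_le (R : ℕ) (u : Fin l → F) (p : F × F) :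
    stepLength l R (u + momentStep l p) ≤ stepLength l R u + 1 := by
  have hsub : ((Finset.range R).filter fun r => u + momentStep l p ∉ stepBall F l r) ⊆
      insert 0 (((Finset.range R).filter fun r => u ∉ stepBall F l r).image (· + 1)) := by
    intro r hr
    obtain ⟨hr1, hr2⟩ := Finset.mem_filter.mp hr
    rcases r with _ | r
    · exact Finset.mem_insert_self _ _
    · refine Finset.mem_insert_of_mem (Finset.mem_image.mpr ⟨r, ?_, rfl⟩)
      rw [Finset.mem_filter]
      refine ⟨Finset.mem_range.mpr ?_, fun h => hr2 (add_momentStep_mem_stepBall l h p)⟩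
      have := Finset.mem_range.mp hr1
      omega
  exact (Finset.card_le_card hsub).trans ((Finset.card_insert_le _ _).trans
    (Nat.add_le_add_right Finset.card_image_le 1))

theorem abs_stepLength_add_sub_le (R : ℕ) (u : Fin l → F) (p : F × F) :
    |(stepLength l R u : ℤ) - stepLength l R (u + momentStep l p)| ≤ 1 := by
  have h1 := stepLength_add_le l R u p
  have h2 := stepLength_add_le l R (u + momentStep l p) (p.1, -p.2)
  rw [momentStep_neg, add_neg_cancel_right] at h2
  rw [abs_le]
  omega

theorem stepLength_eq_of_notMem (R : ℕ) (u : Fin l → F) (hu : u ∉ stepBall F l (R - 1)) :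
    stepLength l R u = R := by
  rw [stepLength, Finset.filter_true_of_mem, Finset.card_range]
  intro r hr h
  refine hu (stepBall_mono l ?_ h)
  have := Finset.mem_range.mp hr
  omega

/-- Expanders on any sufficiently large number of vertices, with a family of `1`-Lipschitz
functions that realizes large distances. -/
theorem exists_expander_with_large_distances (R n : ℕ) (hl : 2 * l ≤ Fintype.card F + 2)
    (hR : 4 * Fintype.card F ^ (2 * (R - 1)) ≤ Fintype.card F ^ l)
    (hn : Fintype.card F ^ l ≤ n) :
    ∃ G : RegularMultigraph (Fin n), HasRealGap G.normAdj 32 ∧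
      (∀ i, 1 / 2 ≤ G.normAdj i i) ∧ ∃ g : Fin n → Fin n → ℤ,
      (∀ k u v, G.mult u v ≠ 0 → |g k u - g k v| ≤ 1) ∧ (∀ k, g k k = 0) ∧
      n ^ 2 ≤ 2 * (Finset.univ.filter fun p : Fin n × Fin n => (R : ℤ) ≤ g p.2 p.1).card := by
  classical
  have hcard : Fintype.card (Fin l → F) = Fintype.card F ^ l := by simp
  obtain ⟨π, hπ⟩ := exists_map_card_fiber (Fin l → F) n (hcard ▸ hn)
  set s := n / Fintype.card (Fin l → F) with hs_def
  have hs : 0 < s := Nat.div_pos (hcard ▸ hn) Fintype.card_pos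
  refine ⟨(momentGraph F l).blowUp π s hs fun v => (hπ v).2, ?_, ?_,
    fun k u => stepLength l R (π u - π k), ?_, ?_, ?_⟩
  · have h := (hasRealGap_momentGraph (F := F) l hl).blowUp one_le_two π s hs
      (fun v => (hπ v).2) (fun v => (hπ v).1)
    norm_num at h
    exact h
  · exact fun i => RegularMultigraph.half_le_normAdj_blowUp _ π s hs _ i
  · intro k u v huv
    rcases RegularMultigraph.of_blowUp_mult_ne_zero _ π s hs _ u v huv with rfl | h
    · simp
    · obtain ⟨p, hp⟩ := exists_of_momentGraph_mult_ne_zero l h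
      beta_reduce
      rw [← hp, add_sub_right_comm]
      exact abs_stepLength_add_sub_le l R _ p
  · intro k
    simp [stepLength_zero]
  · have hsplit := Finset.card_filter_add_card_filter_not (s := Finset.univ)
      (fun p : Fin n × Fin n => (R : ℤ) ≤ (stepLength l R (π p.1 - π p.2) : ℤ))
    rw [Finset.card_univ, Fintype.card_prod, Fintype.card_fin] at hsplit
    -- A near pair is determined, up to at most `2 * s` choices, by its second vertex and a
    -- difference in the ball of radius `R - 1`; `hR` makes such pairs at most half.
    have hnear : 2 * (Finset.univ.filter fun p : Fin n × Fin n =>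
        ¬ (R : ℤ) ≤ (stepLength l R (π p.1 - π p.2) : ℤ)).card ≤ n * n := by
      have h1 : (Finset.univ.filter fun p : Fin n × Fin n =>
          ¬ (R : ℤ) ≤ (stepLength l R (π p.1 - π p.2) : ℤ)).card ≤
          2 * s * (Finset.univ ×ˢ stepBall F l (R - 1) : Finset (Fin n × (Fin l → F))).card := by
        refine Finset.card_le_mul_card_image_of_maps_to (f := fun p => (p.2, π p.1 - π p.2))
          (fun p hp => ?_) _ fun q _ => ?_
        · rw [Finset.mem_product]
          refine ⟨Finset.mem_univ _, ?_⟩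
          by_contra hq
          refine (Finset.mem_filter.mp hp).2 ?_
          rw [stepLength_eq_of_notMem l R _ hq]
        · refine le_trans (Finset.card_le_card_of_injOn Prod.fst (fun p hp => ?_)
            (fun p hp p' hp' h => ?_)) (hπ (q.2 + π q.1)).2
          · have h := (Finset.mem_filter.mp hp).2
            rw [← h]
            simp
          · have e := (Finset.mem_filter.mp hp).2
            have e' := (Finset.mem_filter.mp hp').2
            exact Prod.ext h ((congrArg Prod.fst e).trans (congrArg Prod.fst e').symm)
      rw [Finset.card_product, Finset.card_univ, Fintype.card_fin] at h1
      have h2 : s * Fintype.card F ^ l ≤ n := by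
        rw [← hcard]
        exact Nat.div_mul_le_self _ _
      calc _ ≤ 2 * (2 * s * (n * (stepBall F l (R - 1)).card)) := Nat.mul_le_mul_left _ h1
        _ = n * (s * (4 * (stepBall F l (R - 1)).card)) := by ring
        _ ≤ n * (s * (4 * Fintype.card F ^ (2 * (R - 1)))) := by
            gcongr
            exact card_stepBall_le l _
        _ ≤ n * (s * Fintype.card F ^ l) := by gcongr
        _ ≤ n * n := by gcongr
    nlinarith

end MomentGraph

/-! ### Choice of parameters -/

theorem exists_regularMultigraph_gammaPlus_bounds (m n : ℕ) (hm : 2 ≤ m)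
    (hn : 2 ^ 2 ^ (2 * m) ≤ n) (hn' : n < 2 ^ 2 ^ (2 * m + 2)) :
    ∃ G : RegularMultigraph (Fin n),
      G.gammaPlus (sqDist IntSeq) ≤ ENNReal.ofReal (4096000 * (m : ℝ) ^ 2) ∧
      ENNReal.ofReal ((Real.log (1 + 2 ^ (m - 2)) / Real.log 2) ^ 2 / 2) ≤
        G.gammaPlus (sqDist IntSeq) ∧
      ∀ (t : ℕ) (ht : 1 ≤ t),
        ENNReal.ofReal ((Real.log (1 + 2 ^ (m - 2) / t) / Real.log 2) ^ 2 / 2) ≤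
          (G.cesaro t ht).gammaPlus (sqDist IntSeq) := by
  classical
  have : Fintype (GaloisField 2 m) := Fintype.ofFinite _
  have hF : Fintype.card (GaloisField 2 m) = 2 ^ m := by
    rw [← Nat.card_eq_fintype_card, GaloisField.card 2 m (by omega)]
  obtain ⟨k, rfl⟩ : ∃ k, m = k + 2 := ⟨m - 2, by omega⟩
  have hn1 : 1 ≤ n := le_trans Nat.one_le_two_pow hn
  have : Nonempty (Fin n) := ⟨⟨0, hn1⟩⟩
  -- Here `|F| = 2 ^ m`, `l = |F| / 2` and `R = |F| / 4`, so that `l = 2 * (R - 1) + 2`. The two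
  -- spare factors `|F|` supply the `4` in `hR`.
  obtain ⟨G, hgap, hlazy, g, hg, hg0, hfar⟩ :=
    exists_expander_with_large_distances (F := GaloisField 2 (k + 2)) (2 ^ (k + 1)) (2 ^ k) n
    (by rw [hF, pow_succ 2 (k + 1)]; omega)
    (by
      have h1 : 2 ^ (k + 1) = 2 * (2 ^ k - 1) + 2 := by
        have := Nat.one_le_two_pow (n := k)
        rw [pow_succ]
        omega
      rw [hF, h1, pow_add _ (2 * (2 ^ k - 1)), mul_comm]
      refine Nat.mul_le_mul_left _ ?_
      rw [← pow_mul]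
      calc 4 = 2 ^ 2 := rfl
        _ ≤ _ := Nat.pow_le_pow_right two_pos (by omega))
    (by
      rw [hF, ← pow_mul]
      refine le_trans (Nat.pow_le_pow_right two_pos ?_) hn
      calc (k + 2) * 2 ^ (k + 1) ≤ 2 ^ (k + 2) * 2 ^ (k + 2) :=
            Nat.mul_le_mul Nat.lt_two_pow_self.le (Nat.pow_le_pow_right two_pos (by omega))
        _ = _ := by ring)
  refine ⟨G, ?_, ?_, fun t ht => ?_⟩
  · have hlog2 : 0 < Real.log 2 := Real.log_pos (by norm_num)
    -- By Bernoulli, `128` steps of growth double the ball, and `n < 2 ^ 2 ^ (2 * m + 2)`.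
    have hD : (Fintype.card (Fin n) : ℝ) <
        (1 + 1 / (4 * 32)) ^ (128 * 2 ^ (2 * (k + 2) + 2)) := by
      rw [Fintype.card_fin, pow_mul]
      have h2 : (2 : ℝ) ≤ (1 + 1 / (4 * 32)) ^ 128 := by
        refine le_trans ?_ (one_add_mul_le_pow (by norm_num) 128)
        norm_num
      calc (n : ℝ) < 2 ^ 2 ^ (2 * (k + 2) + 2) := by exact_mod_cast hn'
        _ ≤ _ := by gcongr
    refine (hgap.gammaPlus_le (by norm_num) G.isSymmStochastic_normAdj hlazy _ hD).trans
      (ENNReal.ofReal_le_ofReal ?_)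
    have hL : Real.log (1 + ((128 * 2 ^ (2 * (k + 2) + 2) : ℕ) : ℝ)) / Real.log 2 ≤ 2 * k + 14 := by
      rw [div_le_iff₀ hlog2]
      calc Real.log (1 + ((128 * 2 ^ (2 * (k + 2) + 2) : ℕ) : ℝ))
          ≤ Real.log (2 ^ (2 * k + 14)) := by
            apply Real.log_le_log (by positivity)
            push_cast
            have h1 : (1 : ℝ) ≤ 2 ^ (2 * k) := one_le_pow₀ one_le_two
            rw [show 2 * (k + 2) + 2 = 2 * k + 6 by ring, pow_add, pow_add]
            norm_num
            linarith
        _ = _ := by rw [Real.log_pow]; push_cast; ring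
    have hL0 : 0 ≤ Real.log (1 + ((128 * 2 ^ (2 * (k + 2) + 2) : ℕ) : ℝ)) / Real.log 2 :=
      div_nonneg (Real.log_nonneg (by simp)) hlog2.le
    have hk : (0 : ℝ) ≤ k := Nat.cast_nonneg k
    calc _ ≤ 2000 * 32 * ((8 * (k + 2) : ℝ)) ^ 2 := by
          gcongr
          linarith
      _ = _ := by push_cast; ring
  · simpa using G.le_gammaPlus_of_lipschitz hn1 g 1 (2 ^ k) le_rfl (by simpa using hg) hg0 hfar
  · have := (G.cesaro t ht).le_gammaPlus_of_lipschitz hn1 g t (2 ^ k) ht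
      (fun j u v huv => G.abs_sub_le_of_cesaro_mult_ne_zero (g j) (hg j) t ht u v huv) hg0 hfar
    simpa using this

/-- Division by `t ≤ 2 ^ k` costs at most `k` in the binary logarithm, which is harmless once `m` is
large compared with `k`. -/
theorem half_le_log_one_add_div (m k t : ℕ) (ht : 1 ≤ t) (htk : t ≤ 2 ^ k) (hm : 2 * k + 4 ≤ m) :
    (m : ℝ) / 2 ≤ Real.log (1 + 2 ^ (m - 2) / t) / Real.log 2 := by
  have ht' : (0 : ℝ) < t := by exact_mod_cast ht
  rw [le_div_iff₀ (Real.log_pos one_lt_two)]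
  obtain ⟨j, rfl⟩ : ∃ j, m = k + 2 + j := ⟨m - (k + 2), by omega⟩
  have hj : (k : ℝ) + 2 ≤ j := by
    have : k + 2 ≤ j := by omega
    exact_mod_cast this
  calc ((k + 2 + j : ℕ) : ℝ) / 2 * Real.log 2 ≤ j * Real.log 2 := by
        refine mul_le_mul_of_nonneg_right ?_ (Real.log_nonneg one_le_two)
        push_cast
        linarith
    _ = Real.log (2 ^ j) := (Real.log_pow _ _).symm
    _ ≤ _ := by
        apply Real.log_le_log (by positivity)
        have h1 : (2 : ℝ) ^ j ≤ 2 ^ (k + 2 + j - 2) / t := by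
          rw [le_div_iff₀ ht', show k + 2 + j - 2 = j + k by omega, pow_add]
          gcongr
          exact_mod_cast htk
        linarith

theorem exists_regularMultigraph_slow_decay :
    ∃ η : ℝ, 0 < η ∧ ∃ G : (n : ℕ) → RegularMultigraph (Fin n),
      (∀ n : ℕ, 1 ≤ n → (G n).gammaPlus (sqDist IntSeq) < ⊤) ∧
      Tendsto (fun n : ℕ => (G n).gammaPlus (sqDist IntSeq)) atTop (𝓝 ⊤) ∧
      ∀ (t : ℕ) (ht : 1 ≤ t), ∃ n₀ : ℕ, ∀ n : ℕ, n₀ ≤ n →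
        ENNReal.ofReal η * (G n).gammaPlus (sqDist IntSeq) ≤
          ((G n).cesaro t ht).gammaPlus (sqDist IntSeq) := by
  -- The parameter `m = μ n` places `n` between `2 ^ 2 ^ (2 * m)` and `2 ^ 2 ^ (2 * m + 2)` once `m
  -- ≥ 2`.
  let μ : ℕ → ℕ := fun n => Nat.log 2 (Nat.log 2 n) / 2
  have hμ : ∀ M n : ℕ, 2 ^ 2 ^ (2 * M) ≤ n → M ≤ μ n := by
    intro M n hn
    have h1 := Nat.log_mono_right (b := 2) hn
    rw [Nat.log_pow one_lt_two] at h1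
    have h2 := Nat.log_mono_right (b := 2) h1
    rw [Nat.log_pow one_lt_two] at h2
    simp only [μ]
    omega
  have hex : ∀ n : ℕ, ∃ G : RegularMultigraph (Fin n),
      (1 ≤ n → G.gammaPlus (sqDist IntSeq) < ⊤) ∧ (2 ≤ μ n →
        G.gammaPlus (sqDist IntSeq) ≤ ENNReal.ofReal (4096000 * (μ n : ℝ) ^ 2) ∧
        ENNReal.ofReal ((Real.log (1 + 2 ^ (μ n - 2)) / Real.log 2) ^ 2 / 2) ≤
          G.gammaPlus (sqDist IntSeq) ∧
        ∀ (t : ℕ) (ht : 1 ≤ t),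
          ENNReal.ofReal ((Real.log (1 + 2 ^ (μ n - 2) / t) / Real.log 2) ^ 2 / 2) ≤
            (G.cesaro t ht).gammaPlus (sqDist IntSeq)) := by
    intro n
    by_cases h2 : 2 ≤ μ n
    · have hlog : Nat.log 2 n ≠ 0 := by
        intro h0
        simp [μ, h0] at h2
      have hn0 : n ≠ 0 := by
        rintro rfl
        simp at hlog
      have hlow : 2 ^ 2 ^ (2 * μ n) ≤ n := by
        refine le_trans (Nat.pow_le_pow_right two_pos ?_) (Nat.pow_log_le_self 2 hn0)
        refine le_trans (Nat.pow_le_pow_right two_pos ?_) (Nat.pow_log_le_self 2 hlog)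
        exact Nat.mul_div_le _ _
      have hup : n < 2 ^ 2 ^ (2 * μ n + 2) := by
        refine lt_of_lt_of_le (Nat.lt_pow_succ_log_self one_lt_two n)
          (Nat.pow_le_pow_right two_pos ?_)
        refine le_trans (Nat.lt_pow_succ_log_self one_lt_two (Nat.log 2 n))
          (Nat.pow_le_pow_right two_pos ?_)
        simp only [μ]
        omega
      obtain ⟨G, hG⟩ := exists_regularMultigraph_gammaPlus_bounds (μ n) n h2 hlow hup
      exact ⟨G, fun _ => lt_of_le_of_lt hG.1 ENNReal.ofReal_lt_top, fun _ => hG⟩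
    · rcases n with _ | n
      · exact ⟨⟨fun _ _ => 0, fun _ _ => rfl, 1, one_pos, fun u => u.elim0⟩, by simp,
          fun h => absurd h h2⟩
      · exact ⟨RegularMultigraph.complete _,
          fun _ => RegularMultigraph.gammaPlus_complete_lt_top _ _, fun h => absurd h h2⟩
  choose G hfin hG using hex
  -- The ratio of the lower bound `(m / 2) ^ 2 / 2 = m ^ 2 / 8` for the averages to the upper bound
  -- `4096000 * m ^ 2`.
  refine ⟨1 / 32768000, by norm_num, G, hfin, ?_, fun t ht => ?_⟩
  · rw [ENNReal.tendsto_nhds_top_iff_nat]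
    intro C
    filter_upwards [eventually_ge_atTop (2 ^ 2 ^ (2 * (4 + 3 * (C + 1))))] with n hn
    have hm := hμ _ n hn
    have h1 := (hG n (by omega)).2.1
    refine lt_of_lt_of_le ?_ h1
    rw [← ENNReal.ofReal_natCast, ENNReal.ofReal_lt_ofReal_iff_of_nonneg (Nat.cast_nonneg _)]
    have h2 := half_le_log_one_add_div (μ n) 0 1 le_rfl (by simp) (by omega)
    rw [Nat.cast_one, div_one] at h2
    have h3 : (4 + 3 * (C + 1) : ℝ) ≤ μ n := by exact_mod_cast hm
    have hC : (0 : ℝ) ≤ C := Nat.cast_nonneg C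
    set a := Real.log (1 + 2 ^ (μ n - 2)) / Real.log 2
    have h4 : (C : ℝ) + 3 ≤ a := by linarith
    nlinarith
  -- This forces `μ n ≥ 2 * t + 4`, so `half_le_log_one_add_div` applies with `k = t`, since `t ≤ 2
  -- ^ t`.
  · refine ⟨2 ^ 2 ^ (2 * (2 * t + 4)), fun n hn => ?_⟩
    have hm := hμ _ n hn
    obtain ⟨h1, -, h2⟩ := hG n (by omega)
    refine le_trans ?_ (h2 t ht)
    refine (mul_le_mul_right h1 _).trans ?_
    rw [← ENNReal.ofReal_mul (by norm_num)]
    refine ENNReal.ofReal_le_ofReal ?_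
    have h3 := half_le_log_one_add_div (μ n) t t ht Nat.lt_two_pow_self.le hm
    have h4 := pow_le_pow_left₀ (by positivity) h3 2
    linarith

end SpectralCalculus

open SpectralCalculus in
theorem proposition9p3 :
    (∃ η : ℝ, 0 < η ∧ ∃ G : (n : ℕ) → RegularMultigraph (Fin n),
      (∀ n : ℕ, 1 ≤ n → (G n).gammaPlus (sqDist IntSeq) < ⊤) ∧
      Tendsto (fun n : ℕ => (G n).gammaPlus (sqDist IntSeq)) atTop (𝓝 ⊤) ∧
      ∀ (t : ℕ) (ht : 1 ≤ t), ∃ n₀ : ℕ, ∀ n : ℕ, n₀ ≤ n →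
        ENNReal.ofReal η * (G n).gammaPlus (sqDist IntSeq) ≤
          ((G n).cesaro t ht).gammaPlus (sqDist IntSeq)) ∧
    ¬ UniformDecay (sqDist IntSeq) := by
  refine ⟨exists_regularMultigraph_slow_decay, ?_⟩
  obtain ⟨η, hη, G, hfin, hlim, hces⟩ := exists_regularMultigraph_slow_decay
  exact not_uniformDecay_of_cesaro_lower_bound _ η hη G hfin hlim hces
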